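/- Let $\mu$ be a probability measure on the unit circle $\partial\mathbb{D}$ that is not supported on a finite set, let $\Phi_n$ be its monic orthogonal polynomials, $\varphi_n=\Phi_n/\|\Phi_n\|_{L^2(\mu)}$ its orthonormal polynomials, and $\alpha_n=-\overline{\Phi_{n+1}(0)}$ its Verblunsky coefficients. Write $d\mu=w\,\frac{d\theta}{2\pi}+d\mu_{\mathrm s}$ for the Lebesgue decomposition and $$D(z)=\exp\Bigl(\frac1{4\pi}\int_0^{2\pi}\frac{e^{i\theta}+z}{e^{i\theta}-z}\,\log w(e^{i\theta})\,d\theta\Bigr),\qquad |z|<1,$$ for the Szegő function. **Theorem.** For all $b,\Delta\in(0,1)$ there is $\Delta_2\in(0,1)$, depending only on $b$ and $\Delta$, such that the following holds. Suppose that, for some $C\in\mathbb{C}$ with $C\neq0$, the BLS condition $$\alpha_n=Cb^n+O\bigl((b\Delta)^n\bigr)\qquad(n\to\infty)$$ is satisfied. Then $D(z)^{-1}$ has an analytic continuation from $\mathbb{D}$ to the disk $\{|z|<b^{-1}\}$, again denoted $D(z)^{-1}$, so that $\overline{D(1/\bar z)}^{\,-1}$ is analytic in $\{|z|>b\}$;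 and there is $\Delta_3\in(0,1)$, depending only on $\mu$, $b$ and $\Delta$, such that for every zero $z_0$ of $\overline{D(1/\bar z)}^{\,-1}$ of order $k\ge1$ with $$b<|z_0|<b\,\Delta_2^{-1}$$ there are a constant $C_1\in\mathbb{C}\setminus\{0\}$ and a $\delta>0$ for which, for all large $n$, $\varphi_n$ has exactly $k$ zeros in $\{|z-z_0|<\delta\}$, counted with multiplicity, and these can be labelled $z_n^{(0)},\dots,z_n^{(k-1)}$ so that, as $n\to\infty$, $$z_n^{(j)}=z_0+C_1\Bigl(\frac{b}{|z_0|}\Bigr)^{n/k}\exp\Bigl(-i\,\frac nk\,\arg z_0\Bigr)e^{2\pi ij/k}+O\Bigl(\Bigl(\frac{b\Delta_3}{|z_0|}\Bigr)^{n/k}\Bigr),\qquad j=0,1,\dots,k-1 .$$ Here $\arg z_0\in(-\pi,\pi]$ is the argument in radians. -/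

import Mathlib

open Polynomial MeasureTheory Filter Topology Asymptotics
open scoped ComplexConjugate

namespace OPUC

/-- Nontrivial probability measures on the unit circle, viewed as measures on `ℂ` carried by the
unit circle; nontrivial means that no finite set carries the measure. -/
structure IsNontrivialCircleMeasure (μ : Measure ℂ) : Prop where
  prob : IsProbabilityMeasure μ
  carrier : μ (Metric.sphere (0 : ℂ) 1)ᶜ = 0
  nontrivial : ∀ s : Set ℂ, s.Finite → μ sᶜ ≠ 0

/-- The `L²(μ)` inner product of two polynomials (antilinear in the first argument). -/
noncomputable def polyInner (μ : Measure ℂ) (P Q : ℂ[X]) : ℂ :=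
  ∫ z, conj (P.eval z) * Q.eval z ∂μ

/-- The `L²(μ)` norm of a polynomial. -/
noncomputable def polyNorm (μ : Measure ℂ) (P : ℂ[X]) : ℝ :=
  Real.sqrt (∫ z, ‖P.eval z‖ ^ 2 ∂μ)

/-- The monic orthogonal polynomials `Φₙ` of `μ`, obtained from `1, z, z², …` by the
Gram-Schmidt procedure (without normalization). -/
noncomputable def monicOP (μ : Measure ℂ) (n : ℕ) : ℂ[X] :=
  X ^ n - ∑ i : Fin n,
    C (polyInner μ (monicOP μ i) (X ^ n) / polyInner μ (monicOP μ i) (monicOP μ i)) *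
      monicOP μ i
termination_by n
decreasing_by all_goals exact i.2

/-- The orthonormal polynomials `φₙ = Φₙ / ‖Φₙ‖`. -/
noncomputable def orthonormalOP (μ : Measure ℂ) (n : ℕ) : ℂ[X] :=
  C (((polyNorm μ (monicOP μ n))⁻¹ : ℝ) : ℂ) * monicOP μ n

/-- The Verblunsky coefficients: `αₙ` is minus the complex conjugate of `Φₙ₊₁(0)`. -/
noncomputable def verblunsky (μ : Measure ℂ) (n : ℕ) : ℂ :=
  -conj ((monicOP μ (n + 1)).eval 0)

/-- Normalized arc length `dθ / 2π` on the unit circle, as a measure on `ℂ`. -/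
noncomputable def arcMeasure : Measure ℂ :=
  (ENNReal.ofReal (2 * Real.pi))⁻¹ •
    (volume.restrict (Set.Ioc (0 : ℝ) (2 * Real.pi))).map (circleMap 0 1)

/-- The weight `w` in the Lebesgue decomposition `dμ = w dθ/2π + dμ_s`. -/
noncomputable def weight (μ : Measure ℂ) (ζ : ℂ) : ℝ :=
  (μ.rnDeriv arcMeasure ζ).toReal

/-- The Szegő function of `μ` in the open unit disk,
`D(z) = exp ((1/4π) ∫ (e^{iθ} + z) / (e^{iθ} - z) log w(e^{iθ}) dθ)`. -/
noncomputable def szegoD (μ : Measure ℂ) (z : ℂ) : ℂ :=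
  Complex.exp ((1 / (4 * Real.pi) : ℂ) * ∫ θ in (0 : ℝ)..(2 * Real.pi),
    (circleMap 0 1 θ + z) / (circleMap 0 1 θ - z) * (Real.log (weight μ (circleMap 0 1 θ)) : ℂ))

/-- `G` is the analytic continuation of `1 / D` from the unit disk to the disk `|z| < R`. -/
structure IsSzegoInvContinuation (μ : Measure ℂ) (R : ℝ) (G : ℂ → ℂ) : Prop where
  analytic : AnalyticOnNhd ℂ G (Metric.ball 0 R)
  eq_inv : ∀ z ∈ Metric.ball (0 : ℂ) 1, G z = (szegoD μ z)⁻¹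

/-- The BLS condition `αₙ = C bⁿ + O((bΔ)ⁿ)`. -/
def BLSCondition (μ : Measure ℂ) (C : ℂ) (b Δ : ℝ) : Prop :=
  (fun n : ℕ => verblunsky μ n - C * (b : ℂ) ^ n) =O[atTop] fun n : ℕ => (b * Δ) ^ n

open Classical in
/-- The zeros of `P` in the open disk `|z - z₀| < r`, counted with multiplicity. -/
noncomputable def zerosInBall (P : ℂ[X]) (z₀ : ℂ) (r : ℝ) : Multiset ℂ :=
  P.roots.filter fun z => z ∈ Metric.ball z₀ r

end OPUC

/-! ### The Szegő recursion: reflection and bounds on the closed disk. -/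

namespace OPUC

/-! The recursion gives Φₙ* = 1 - ∑_{m<n} α_m z Φ_m. On |z| ≤ r with r ≥ 1, Φ_m is O(r^m) while α_m
is O(b^m), so Φₙ* converges in |z| < 1/b to an analytic F with F(0) = 1, and F has no zeros on the
closed unit disk. Orthogonality of Φₙ* to z, …, zⁿ passes to the limit, and comparison of moments
yields |F|² dμ = N dθ/2π with N = ∫ |F|² dμ. Hence w = N/|F|² almost everywhere, and the Schwarz
integral formula gives D = √N/F (`ExpDecay.szegoD_eq`). The required continuation of 1/D is
therefore F/√N.

The zeros of Φₙ inside the disk are reached through the reflection Φₙ(z) = zⁿ conj(Φₙ*(1/z̄)). For b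
< |z| ≤ 1 the reflected tail of the series for F has terms z^{-m-1} conj(α_m) Φ_m*(z). Replacing
these by z^{-m-1} conj(C) b^m F(z) gives a geometric series, so that conj(Φₙ*(1/z̄)) = conj(F(1/z̄))
+ (b/z)ⁿ conj(C) F(z)/(z - b) + O((bΔ/|z|)ⁿ), where Δ has first been enlarged to be at least b
(`LeadingDecay.conj_szegoRev_eq`). Near a zero z₀ of order k this becomes (z - z₀)^k = (b/z)ⁿ q(z) +
eₙ(z), with q(z₀) ≠ 0 because C and F(z₀) do not vanish. With cₙ^k = q(z₀)(b/z₀)ⁿ and z = z₀ + cₙ v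
the equation reads v^k = 1 + τ(v) with τ exponentially small, so its solutions are simple and lie
near the k-th roots of unity (`exists_roots_of_perturbation`, `LocalEquation.exists_zeros`).

Replacing b/z by b/z₀ costs a relative error of order n|cₙ|, which is absorbed in the rate only if
b/|z₀| < Δ₃. A single Δ₃ serves all z₀ because the zeros stay away from |z| = b: multiplied by z -
b, the reflected limit continues analytically across that circle
(`LeadingDecay.exists_radius_le_of_zero`). -/

/-- The pair `(Φₙ, Φₙ*)` generated by the Szegő recursion with Verblunsky coefficients `α`. -/
noncomputable def szegoPair (α : ℕ → ℂ) : ℕ → ℂ[X] × ℂ[X]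
  | 0 => (1, 1)
  | n + 1 => (X * (szegoPair α n).1 - C (conj (α n)) * (szegoPair α n).2,
      (szegoPair α n).2 - C (α n) * (X * (szegoPair α n).1))

/-- The monic polynomial `Φₙ` generated by the Szegő recursion. -/
noncomputable def szegoPoly (α : ℕ → ℂ) (n : ℕ) : ℂ[X] := (szegoPair α n).1

/-- The reversed polynomial `Φₙ*` generated by the Szegő recursion. -/
noncomputable def szegoRev (α : ℕ → ℂ) (n : ℕ) : ℂ[X] := (szegoPair α n).2

variable (α : ℕ → ℂ)

@[simp] lemma szegoPoly_zero : szegoPoly α 0 = 1 := rfl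

@[simp] lemma szegoRev_zero : szegoRev α 0 = 1 := rfl

lemma szegoPoly_succ (n : ℕ) :
    szegoPoly α (n + 1) = X * szegoPoly α n - C (conj (α n)) * szegoRev α n := rfl

lemma szegoRev_succ (n : ℕ) :
    szegoRev α (n + 1) = szegoRev α n - C (α n) * (X * szegoPoly α n) := rfl

lemma eval_szegoPoly_succ (n : ℕ) (z : ℂ) :
    (szegoPoly α (n + 1)).eval z
      = z * (szegoPoly α n).eval z - conj (α n) * (szegoRev α n).eval z := by
  simp [szegoPoly_succ]

lemma eval_szegoRev_succ (n : ℕ) (z : ℂ) :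
    (szegoRev α (n + 1)).eval z
      = (szegoRev α n).eval z - α n * (z * (szegoPoly α n).eval z) := by
  simp [szegoRev_succ]

/-- The map z ↦ 1/z̄ with conjugation interchanges the two lines of the recursion. This converts
information inside the disk into information outside it, and conversely. -/
lemma eval_szego_reflect {z : ℂ} (hz : z ≠ 0) (n : ℕ) :
    (szegoPoly α n).eval z = z ^ n * conj ((szegoRev α n).eval (1 / conj z)) ∧
    (szegoRev α n).eval z = z ^ n * conj ((szegoPoly α n).eval (1 / conj z)) := by
  induction n with
  | zero => simp
  | succ n ih =>
    have h : conj (1 / conj z) = 1 / z := by simp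
    constructor
    · rw [eval_szegoPoly_succ, eval_szegoRev_succ, ih.1, ih.2]
      simp only [map_sub, map_mul, h]
      field_simp
      ring
    · rw [eval_szegoRev_succ, eval_szegoPoly_succ, ih.1, ih.2]
      simp only [map_sub, map_mul, h, Complex.conj_conj]
      field_simp
      ring

lemma eval_szegoRev_of_norm_eq_one {z : ℂ} (hz : ‖z‖ = 1) (n : ℕ) :
    (szegoRev α n).eval z = z ^ n * conj ((szegoPoly α n).eval z) := by
  have hz0 : z ≠ 0 := by rintro rfl; simp at hz
  have h : 1 / conj z = z := by
    have := Complex.mul_conj' z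
    rw [div_eq_iff (by simpa using hz0), this, hz]
    simp
  have := (eval_szego_reflect α hz0 n).2
  rwa [h] at this

lemma natDegree_szego_le (n : ℕ) :
    (szegoPoly α n).natDegree ≤ n ∧ (szegoRev α n).natDegree ≤ n := by
  induction n with
  | zero => simp
  | succ n ih =>
    have h1 : (X * szegoPoly α n).natDegree ≤ n + 1 :=
      natDegree_mul_le.trans (by simpa [add_comm 1] using ih.1)
    have h2 (c : ℂ) : (C c * (X * szegoPoly α n)).natDegree ≤ n + 1 :=
      (natDegree_C_mul_le _ _).trans h1
    refine ⟨?_, ?_⟩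
    · rw [szegoPoly_succ]
      simpa using natDegree_sub_le_of_le h1 ((natDegree_C_mul_le (conj (α n)) _).trans (ih.2.trans n.le_succ))
    · rw [szegoRev_succ]
      simpa using natDegree_sub_le_of_le (ih.2.trans n.le_succ) (h2 (α n))

@[simp] lemma eval_zero_szegoRev (n : ℕ) : (szegoRev α n).eval 0 = 1 := by
  induction n with
  | zero => simp
  | succ n ih => simp [eval_szegoRev_succ, ih]

lemma eval_zero_szegoPoly_succ (n : ℕ) : (szegoPoly α (n + 1)).eval 0 = -conj (α n) := by
  simp [eval_szegoPoly_succ]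

/-- The recursion step acts on the quotient zΦₙ/Φₙ* as a Möbius self-map of the disk; the identity
`key` is its division-free form. -/
lemma norm_szegoPoly_le_szegoRev (hα : ∀ n, ‖α n‖ ≤ 1) {z : ℂ} (hz : ‖z‖ ≤ 1) (n : ℕ) :
    ‖(szegoPoly α n).eval z‖ ≤ ‖(szegoRev α n).eval z‖ := by
  induction n with
  | zero => simp
  | succ n ih =>
    rw [eval_szegoPoly_succ, eval_szegoRev_succ]
    set a := (szegoRev α n).eval z
    set p := z * (szegoPoly α n).eval z with hp
    have hpa : ‖p‖ ≤ ‖a‖ := by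
      rw [hp, norm_mul]
      nlinarith [norm_nonneg ((szegoPoly α n).eval z)]
    have key : ‖a - α n * p‖ ^ 2 - ‖p - conj (α n) * a‖ ^ 2
        = (1 - ‖α n‖ ^ 2) * (‖a‖ ^ 2 - ‖p‖ ^ 2) := by
      simp only [← Complex.normSq_eq_norm_sq, Complex.normSq_apply]
      simp
      ring
    have h1 : 0 ≤ (1 - ‖α n‖ ^ 2) * (‖a‖ ^ 2 - ‖p‖ ^ 2) := by
      apply mul_nonneg
      · nlinarith [hα n, norm_nonneg (α n)]
      · nlinarith [norm_nonneg p]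
    exact (sq_le_sq₀ (norm_nonneg _) (norm_nonneg _)).1 (by linarith)

lemma one_sub_mul_norm_szegoRev_le (hα : ∀ n, ‖α n‖ ≤ 1) {z : ℂ} (hz : ‖z‖ ≤ 1) (n : ℕ) :
    (1 - ‖α n‖) * ‖(szegoRev α n).eval z‖ ≤ ‖(szegoRev α (n + 1)).eval z‖ := by
  rw [eval_szegoRev_succ]
  have h := norm_szegoPoly_le_szegoRev α hα hz n
  have h1 := norm_sub_norm_le ((szegoRev α n).eval z) (α n * (z * (szegoPoly α n).eval z))
  rw [norm_mul, norm_mul] at h1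
  have h2 : ‖z‖ * ‖(szegoPoly α n).eval z‖ ≤ ‖(szegoRev α n).eval z‖ := by
    nlinarith [norm_nonneg ((szegoPoly α n).eval z)]
  nlinarith [norm_nonneg (α n)]

/-- When the coefficients are summable and all of modulus below 1, these products have a nonzero
limit, which keeps the limit of Φₙ* away from zero. -/
lemma prod_le_norm_szegoRev (hα : ∀ n, ‖α n‖ ≤ 1) {z : ℂ} (hz : ‖z‖ ≤ 1) (n : ℕ) :
    ∏ i ∈ Finset.range n, (1 - ‖α i‖) ≤ ‖(szegoRev α n).eval z‖ := by
  induction n with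
  | zero => simp
  | succ n ih =>
    rw [Finset.prod_range_succ, mul_comm]
    exact (mul_le_mul_of_nonneg_left ih (by linarith [hα n])).trans
      (one_sub_mul_norm_szegoRev_le α hα hz n)

lemma norm_szego_le_prod {z : ℂ} (hz : ‖z‖ ≤ 1) (n : ℕ) :
    ‖(szegoPoly α n).eval z‖ ≤ ∏ i ∈ Finset.range n, (1 + ‖α i‖) ∧
    ‖(szegoRev α n).eval z‖ ≤ ∏ i ∈ Finset.range n, (1 + ‖α i‖) := by
  induction n with
  | zero => simp
  | succ n ih =>
    have hp : ‖z * (szegoPoly α n).eval z‖ ≤ ∏ i ∈ Finset.range n, (1 + ‖α i‖) := by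
      rw [norm_mul]
      nlinarith [norm_nonneg ((szegoPoly α n).eval z), ih.1]
    rw [Finset.prod_range_succ, eval_szegoPoly_succ, eval_szegoRev_succ]
    have h1 := norm_sub_le (z * (szegoPoly α n).eval z) (conj (α n) * (szegoRev α n).eval z)
    have h2 := norm_sub_le ((szegoRev α n).eval z) (α n * (z * (szegoPoly α n).eval z))
    rw [norm_mul (conj _), RCLike.norm_conj] at h1
    rw [norm_mul (α n)] at h2
    constructor <;> nlinarith [norm_nonneg (α n), ih.2]

end OPUC

/-! ### Orthogonality, and the recursion for the orthogonal polynomials of μ. -/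

namespace OPUC

variable {μ : Measure ℂ}

lemma ae_norm_eq_one (hμ : μ (Metric.sphere (0 : ℂ) 1)ᶜ = 0) : ∀ᵐ z ∂μ, ‖z‖ = 1 := by
  have : ∀ᵐ z ∂μ, z ∈ Metric.sphere (0 : ℂ) 1 := by
    rw [ae_iff]; exact hμ
  filter_upwards [this] with z hz using by simpa using hz

lemma restrict_sphere_eq (hμ : μ (Metric.sphere (0 : ℂ) 1)ᶜ = 0) :
    μ.restrict (Metric.sphere (0 : ℂ) 1) = μ :=
  Measure.restrict_eq_self_of_ae_mem (by rw [ae_iff]; exact hμ)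

lemma integrable_of_continuousOn_sphere {E : Type*} [NormedAddCommGroup E] [IsFiniteMeasure μ]
    (hμ : μ (Metric.sphere (0 : ℂ) 1)ᶜ = 0) {f : ℂ → E}
    (hf : ContinuousOn f (Metric.sphere (0 : ℂ) 1)) : Integrable f μ := by
  have h := hf.integrableOn_compact (μ := μ) (isCompact_sphere (0 : ℂ) 1)
  rwa [IntegrableOn, restrict_sphere_eq hμ] at h

lemma integrable_of_continuous {E : Type*} [NormedAddCommGroup E]
    (hμ : IsNontrivialCircleMeasure μ) {f : ℂ → E} (hf : Continuous f) : Integrable f μ :=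
  have := hμ.prob
  integrable_of_continuousOn_sphere hμ.carrier hf.continuousOn

lemma continuous_polyInner_integrand (P Q : ℂ[X]) :
    Continuous fun z => conj (P.eval z) * Q.eval z :=
  (Complex.continuous_conj.comp P.continuous).mul Q.continuous

lemma polyInner_sub_right (hμ : IsNontrivialCircleMeasure μ) (P Q R : ℂ[X]) :
    polyInner μ P (Q - R) = polyInner μ P Q - polyInner μ P R := by
  simp only [polyInner, eval_sub, mul_sub]
  exact integral_sub (integrable_of_continuous hμ (continuous_polyInner_integrand P Q))
    (integrable_of_continuous hμ (continuous_polyInner_integrand P R))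

lemma polyInner_add_right (hμ : IsNontrivialCircleMeasure μ) (P Q R : ℂ[X]) :
    polyInner μ P (Q + R) = polyInner μ P Q + polyInner μ P R := by
  simp only [polyInner, eval_add, mul_add]
  exact integral_add (integrable_of_continuous hμ (continuous_polyInner_integrand P Q))
    (integrable_of_continuous hμ (continuous_polyInner_integrand P R))

lemma polyInner_C_mul_right (c : ℂ) (P Q : ℂ[X]) :
    polyInner μ P (C c * Q) = c * polyInner μ P Q := by
  simp only [polyInner, eval_mul, eval_C]
  rw [← integral_const_mul]
  congr 1; ext z; ring

lemma polyInner_sum_right (hμ : IsNontrivialCircleMeasure μ) {ι : Type*} (s : Finset ι) (P : ℂ[X])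
    (Q : ι → ℂ[X]) : polyInner μ P (∑ i ∈ s, Q i) = ∑ i ∈ s, polyInner μ P (Q i) := by
  simp only [polyInner, eval_finsetSum, Finset.mul_sum]
  exact integral_finsetSum _ fun i _ =>
    integrable_of_continuous hμ (continuous_polyInner_integrand P (Q i))

lemma conj_polyInner (P Q : ℂ[X]) : conj (polyInner μ P Q) = polyInner μ Q P := by
  rw [polyInner, ← integral_conj, polyInner]
  congr 1; ext z; simp [mul_comm]

lemma polyInner_add_left (hμ : IsNontrivialCircleMeasure μ) (P Q R : ℂ[X]) :
    polyInner μ (P + Q) R = polyInner μ P R + polyInner μ Q R := by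
  rw [← conj_polyInner, polyInner_add_right hμ, map_add, conj_polyInner, conj_polyInner]

lemma polyInner_C_mul_left (c : ℂ) (P Q : ℂ[X]) :
    polyInner μ (C c * P) Q = conj c * polyInner μ P Q := by
  rw [← conj_polyInner, polyInner_C_mul_right, map_mul, conj_polyInner]

lemma polyInner_self (P : ℂ[X]) : polyInner μ P P = ((∫ z, ‖P.eval z‖ ^ 2 ∂μ : ℝ) : ℂ) := by
  rw [polyInner, ← integral_complex_ofReal]
  congr 1; ext z
  rw [mul_comm, Complex.mul_conj']
  push_cast; rfl

lemma integral_norm_sq_pos (hμ : IsNontrivialCircleMeasure μ) {P : ℂ[X]} (hP : P ≠ 0) :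
    0 < ∫ z, ‖P.eval z‖ ^ 2 ∂μ := by
  rw [integral_pos_iff_support_of_nonneg (fun z => by positivity)
    (integrable_of_continuous hμ (by fun_prop))]
  have h := hμ.nontrivial (P.roots.toFinset : Set ℂ) (Finset.finite_toSet _)
  refine (pos_iff_ne_zero.2 h).trans_le (measure_mono ?_)
  intro z hz
  simp only [Function.mem_support]
  intro h0
  apply hz
  have : P.eval z = 0 := by simpa using h0
  simp [hP, this]

lemma polyInner_self_ne_zero (hμ : IsNontrivialCircleMeasure μ) {P : ℂ[X]} (hP : P ≠ 0) :
    polyInner μ P P ≠ 0 := by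
  rw [polyInner_self]
  exact_mod_cast (integral_norm_sq_pos hμ hP).ne'

lemma eq_zero_of_polyInner_self (hμ : IsNontrivialCircleMeasure μ) {P : ℂ[X]}
    (h : polyInner μ P P = 0) : P = 0 := by
  by_contra hP
  exact polyInner_self_ne_zero hμ hP h

lemma monicOP_eq (μ : Measure ℂ) (n : ℕ) :
    monicOP μ n = X ^ n - ∑ i : Fin n,
      C (polyInner μ (monicOP μ i) (X ^ n) / polyInner μ (monicOP μ i) (monicOP μ i)) *
        monicOP μ i := by
  rw [monicOP]

lemma monicOP_monic_and_natDegree (μ : Measure ℂ) (n : ℕ) :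
    (monicOP μ n).Monic ∧ (monicOP μ n).natDegree = n := by
  induction n using Nat.strong_induction_on with
  | _ n ih =>
    have hdeg : (∑ i : Fin n,
        C (polyInner μ (monicOP μ i) (X ^ n) / polyInner μ (monicOP μ i) (monicOP μ i)) *
          monicOP μ i).degree < n := by
      rw [← mem_degreeLT]
      refine Submodule.sum_mem _ fun i _ => ?_
      rw [← smul_eq_C_mul]
      refine Submodule.smul_mem _ _ (mem_degreeLT.2 ?_)
      rw [degree_eq_natDegree (ih i i.2).1.ne_zero, (ih i i.2).2]
      exact_mod_cast i.2
    rw [monicOP_eq]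
    have h1 : (X ^ n : ℂ[X]).degree = n := degree_X_pow n
    refine ⟨(monic_X_pow n).sub_of_left (by rwa [h1]), ?_⟩
    apply natDegree_eq_of_degree_eq_some
    rw [degree_sub_eq_left_of_degree_lt (by rwa [h1]), h1]

lemma monicOP_monic (μ : Measure ℂ) (n : ℕ) : (monicOP μ n).Monic :=
  (monicOP_monic_and_natDegree μ n).1

lemma natDegree_monicOP (μ : Measure ℂ) (n : ℕ) : (monicOP μ n).natDegree = n :=
  (monicOP_monic_and_natDegree μ n).2

lemma polyInner_monicOP_of_lt (hμ : IsNontrivialCircleMeasure μ) (n : ℕ) :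
    ∀ j < n, polyInner μ (monicOP μ j) (monicOP μ n) = 0 := by
  induction n using Nat.strong_induction_on with
  | _ n ih =>
    intro j hj
    rw [monicOP_eq μ n, polyInner_sub_right hμ, polyInner_sum_right hμ,
      Finset.sum_eq_single (⟨j, hj⟩ : Fin n)]
    · rw [polyInner_C_mul_right,
        div_mul_cancel₀ _ (polyInner_self_ne_zero hμ (monicOP_monic μ j).ne_zero), sub_self]
    · intro i _ hij
      rw [polyInner_C_mul_right]
      have hne : (i : ℕ) ≠ j := fun h => hij (Fin.ext h)
      rcases lt_or_gt_of_ne hne with h | h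
      · rw [← conj_polyInner (monicOP μ i) (monicOP μ j), ih j hj i h]; simp
      · rw [ih i i.2 j h, mul_zero]
    · simp

/-- The monic orthogonal polynomial `Φₙ` is orthogonal to every polynomial of degree below `n`. -/
lemma polyInner_monicOP_of_degree_lt (hμ : IsNontrivialCircleMeasure μ) {n : ℕ} {P : ℂ[X]}
    (hP : P.degree < n) : polyInner μ P (monicOP μ n) = 0 := by
  suffices H : ∀ d ≤ n, ∀ P : ℂ[X], P.degree < d → polyInner μ P (monicOP μ n) = 0 from
    H n le_rfl P hP
  intro d
  induction d with
  | zero =>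
    intro _ P hP
    have : P = 0 := by simpa using hP
    simp [this, polyInner]
  | succ d ih =>
    intro hd P hP
    have hsplit : P = (P - C (P.coeff d) * monicOP μ d) + C (P.coeff d) * monicOP μ d := by ring
    have hlow : (P - C (P.coeff d) * monicOP μ d).degree < d := by
      rw [degree_lt_iff_coeff_zero]
      intro m hm
      rw [coeff_sub, coeff_C_mul]
      rcases hm.eq_or_lt with rfl | hm
      · have : (monicOP μ d).coeff d = 1 := by
          have := (monicOP_monic μ d).coeff_natDegree
          rwa [natDegree_monicOP] at this
        rw [this]; ring
      · rw [(degree_lt_iff_coeff_zero _ _).1 hP m hm,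
          coeff_eq_zero_of_natDegree_lt (p := monicOP μ d) (by rwa [natDegree_monicOP])]
        ring
    rw [hsplit, polyInner_add_left hμ, ih (by omega) _ hlow, polyInner_C_mul_left,
      polyInner_monicOP_of_lt hμ n d (by omega)]
    ring

/-- On the circle z̄ = 1/z, so reversal of degree n exchanges the exponents j and n - j.
Orthogonality of Φₙ to 1, …, z^{n-1} thus becomes orthogonality of Φₙ* to z, …, zⁿ. -/
lemma polyInner_X_pow_eq_of_reversed (hμ : IsNontrivialCircleMeasure μ) {n j : ℕ} (hj : j ≤ n)
    {P R : ℂ[X]} (hR : ∀ z : ℂ, ‖z‖ = 1 → R.eval z = z ^ n * conj (P.eval z)) :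
    polyInner μ (X ^ j) R = conj (polyInner μ (X ^ (n - j)) P) := by
  rw [polyInner, polyInner, ← integral_conj]
  apply integral_congr_ae
  filter_upwards [ae_norm_eq_one hμ.carrier] with z hz
  have h1 : conj z * z = 1 := by rw [mul_comm, Complex.mul_conj', hz]; simp
  rw [hR z hz]
  simp only [eval_pow, eval_X, map_mul, map_pow, Complex.conj_conj]
  calc conj z ^ j * (z ^ n * conj (P.eval z))
      = (conj z * z) ^ j * (z ^ (n - j) * conj (P.eval z)) := by
        rw [mul_pow, ← Nat.add_sub_cancel' hj, pow_add]
        simp; ring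
    _ = _ := by rw [h1]; simp

/-- Such an R lies in the span of z, …, zⁿ and is orthogonal to that span, hence to itself. -/
lemma polyInner_eq_zero_of_X_pow (hμ : IsNontrivialCircleMeasure μ) {n : ℕ} {R : ℂ[X]}
    (h0 : R.eval 0 = 0) (hdeg : R.natDegree ≤ n)
    (horth : ∀ j, 1 ≤ j → j ≤ n → polyInner μ (X ^ j) R = 0) : R = 0 := by
  apply eq_zero_of_polyInner_self hμ
  rw [← conj_polyInner]
  nth_rewrite 2 [R.as_sum_range_C_mul_X_pow]
  rw [polyInner_sum_right hμ, map_sum]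
  apply Finset.sum_eq_zero
  intro j hj
  rw [polyInner_C_mul_right, map_mul, conj_polyInner]
  rcases Nat.eq_zero_or_pos j with rfl | hj0
  · rw [coeff_zero_eq_eval_zero, h0]; simp
  · rw [horth j hj0 (by have := Finset.mem_range.1 hj; omega), mul_zero]

/-- **Szegő recursion**: the monic orthogonal polynomials are generated by the Verblunsky
coefficients. -/
theorem monicOP_eq_szegoPoly (hμ : IsNontrivialCircleMeasure μ) (n : ℕ) :
    monicOP μ n = szegoPoly (verblunsky μ) n := by
  induction n with
  | zero => rw [monicOP_eq]; simp
  | succ n ih =>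
    set α := verblunsky μ
    have hrev := fun (z : ℂ) (hz : ‖z‖ = 1) => eval_szegoRev_of_norm_eq_one α hz n
    rw [← sub_eq_zero]
    -- For the difference of the two candidates, the constant terms agree by the definition of αₙ,
    -- the leading terms cancel so the degree is at most n, and both candidates are orthogonal to z,
    -- …, zⁿ.
    apply polyInner_eq_zero_of_X_pow hμ (n := n)
    · rw [eval_sub, eval_zero_szegoPoly_succ]
      simp [α, verblunsky]
    · have h1 := monicOP_monic μ (n + 1)
      have hd1 := natDegree_monicOP μ (n + 1)
      have hX : (X * monicOP μ n).natDegree = n + 1 := by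
        rw [natDegree_X_mul (monicOP_monic μ n).ne_zero, natDegree_monicOP]
      have hXm : (X * monicOP μ n).Monic := monic_X.mul (monicOP_monic μ n)
      have hlt : (monicOP μ (n + 1) - X * monicOP μ n).degree < ((n + 1 : ℕ) : WithBot ℕ) := by
        have := degree_sub_lt_left (p := monicOP μ (n + 1)) (q := X * monicOP μ n)
          (by rw [degree_eq_natDegree h1.ne_zero, degree_eq_natDegree hXm.ne_zero, hd1, hX])
          h1.ne_zero (by rw [h1.leadingCoeff, hXm.leadingCoeff])
        rwa [degree_eq_natDegree h1.ne_zero, hd1] at this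
      have heq : monicOP μ (n + 1) - szegoPoly α (n + 1)
          = (monicOP μ (n + 1) - X * monicOP μ n) + C (conj (α n)) * szegoRev α n := by
        rw [szegoPoly_succ, ← ih]; ring
      rw [heq]
      refine natDegree_add_le_of_degree_le ?_
        ((natDegree_C_mul_le _ _).trans (natDegree_szego_le α n).2)
      rw [natDegree_le_iff_coeff_eq_zero]
      exact fun m hm => (degree_lt_iff_coeff_zero _ _).1 hlt m hm
    · intro j hj1 hjn
      rw [polyInner_sub_right hμ, polyInner_monicOP_of_degree_lt hμ
        (by rw [degree_X_pow]; exact_mod_cast Nat.lt_succ_of_le hjn),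
        szegoPoly_succ, polyInner_sub_right hμ, polyInner_C_mul_right,
        polyInner_X_pow_eq_of_reversed hμ hjn hrev, ← ih,
        polyInner_monicOP_of_degree_lt hμ
          (by rw [degree_X_pow]; exact_mod_cast (by omega : n - j < n))]
      have : polyInner μ (X ^ j) (X * monicOP μ n) = polyInner μ (X ^ (j - 1)) (monicOP μ n) := by
        apply integral_congr_ae
        filter_upwards [ae_norm_eq_one hμ.carrier] with z hz
        have h1 : conj z * z = 1 := by rw [mul_comm, Complex.mul_conj', hz]; simp
        obtain ⟨i, rfl⟩ : ∃ i, j = i + 1 := ⟨j - 1, by omega⟩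
        simp only [eval_mul, eval_pow, eval_X, map_pow, Nat.add_sub_cancel]
        rw [pow_succ]
        linear_combination (conj z ^ i * (monicOP μ n).eval z) * h1
      rw [this, polyInner_monicOP_of_degree_lt hμ
        (by rw [degree_X_pow]; exact_mod_cast (by omega : j - 1 < n))]
      simp

lemma polyInner_X_pow_szegoRev (hμ : IsNontrivialCircleMeasure μ) {n j : ℕ} (hj : 1 ≤ j)
    (hjn : j ≤ n) : polyInner μ (X ^ j) (szegoRev (verblunsky μ) n) = 0 := by
  rw [polyInner_X_pow_eq_of_reversed hμ hjn
    (fun z hz => eval_szegoRev_of_norm_eq_one (verblunsky μ) hz n), ← monicOP_eq_szegoPoly hμ,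
    polyInner_monicOP_of_degree_lt hμ
      (by rw [degree_X_pow]; exact_mod_cast (by omega : n - j < n)), map_zero]

lemma norm_szegoRev_of_norm_eq_one (α : ℕ → ℂ) {z : ℂ} (hz : ‖z‖ = 1) (n : ℕ) :
    ‖(szegoRev α n).eval z‖ = ‖(szegoPoly α n).eval z‖ := by
  rw [eval_szegoRev_of_norm_eq_one α hz]; simp [hz]

/-- The norms of the monic orthogonal polynomials satisfy
`‖Φₙ₊₁‖² = (1 - |αₙ|²) ‖Φₙ‖²`. -/
lemma integral_norm_sq_monicOP_succ (hμ : IsNontrivialCircleMeasure μ) (n : ℕ) :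
    ∫ z, ‖(monicOP μ (n + 1)).eval z‖ ^ 2 ∂μ
      = (1 - ‖verblunsky μ n‖ ^ 2) * ∫ z, ‖(monicOP μ n).eval z‖ ^ 2 ∂μ := by
  set α := verblunsky μ
  have hQ : polyInner μ (szegoRev α n) (szegoRev α n) = polyInner μ (monicOP μ n) (monicOP μ n) := by
    rw [polyInner_self, polyInner_self]
    congr 1
    apply integral_congr_ae
    filter_upwards [ae_norm_eq_one hμ.carrier] with z hz
    rw [norm_szegoRev_of_norm_eq_one α hz, monicOP_eq_szegoPoly hμ]
  have hX : polyInner μ (X * monicOP μ n) (X * monicOP μ n)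
      = polyInner μ (monicOP μ n) (monicOP μ n) := by
    rw [polyInner_self, polyInner_self]
    congr 1
    apply integral_congr_ae
    filter_upwards [ae_norm_eq_one hμ.carrier] with z hz
    simp [hz]
  have hQP : polyInner μ (szegoRev α n) (monicOP μ (n + 1)) = 0 :=
    polyInner_monicOP_of_degree_lt hμ ((degree_le_of_natDegree_le (natDegree_szego_le α n).2).trans_lt
      (by exact_mod_cast n.lt_succ_self))
  have hPQ : polyInner μ (monicOP μ (n + 1)) (szegoRev α n) = 0 := by
    rw [← conj_polyInner, hQP, map_zero]
  have hrec : X * monicOP μ n = monicOP μ (n + 1) + C (conj (α n)) * szegoRev α n := by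
    rw [monicOP_eq_szegoPoly hμ, monicOP_eq_szegoPoly hμ, szegoPoly_succ]; ring
  rw [hrec, polyInner_add_left hμ, polyInner_add_right hμ, polyInner_add_right hμ,
    polyInner_C_mul_left, polyInner_C_mul_left, polyInner_C_mul_right, polyInner_C_mul_right, hQ,
    hQP, hPQ, polyInner_self, polyInner_self] at hX
  have h2 : conj (conj (α n)) * conj (α n) = ((‖α n‖ ^ 2 : ℝ) : ℂ) := by
    rw [Complex.conj_conj, Complex.mul_conj']; push_cast; rfl
  have h3 : ((∫ z, ‖(monicOP μ (n + 1)).eval z‖ ^ 2 ∂μ : ℝ) : ℂ)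
      = (((1 - ‖α n‖ ^ 2) * ∫ z, ‖(monicOP μ n).eval z‖ ^ 2 ∂μ : ℝ) : ℂ) := by
    rw [Complex.ofReal_mul, Complex.ofReal_sub, ← h2]
    simp only [Complex.ofReal_one]
    linear_combination hX
  exact_mod_cast h3

/-- Both norms in the norm recursion are positive because μ is nontrivial, so 1 - |αₙ|² must be
positive. -/
lemma norm_verblunsky_lt_one (hμ : IsNontrivialCircleMeasure μ) (n : ℕ) :
    ‖verblunsky μ n‖ < 1 := by
  have h := integral_norm_sq_monicOP_succ hμ n
  have h1 := integral_norm_sq_pos hμ (monicOP_monic μ n).ne_zero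
  have h2 := integral_norm_sq_pos hμ (monicOP_monic μ (n + 1)).ne_zero
  rw [h] at h2
  have h3 := pos_of_mul_pos_left h2 h1.le
  nlinarith [norm_nonneg (verblunsky μ n)]

end OPUC

/-! ### The limit of the reversed polynomials under exponential decay. -/

namespace OPUC

/-- Exponential decay of a sequence of Verblunsky coefficients. -/
structure ExpDecay (α : ℕ → ℂ) (b A : ℝ) : Prop where
  pos : 0 < b
  lt_one : b < 1
  bound : ∀ n, ‖α n‖ ≤ A * b ^ n

/-- The limit of the reversed polynomials `Φₙ*` generated by the Szegő recursion. -/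
noncomputable def szegoLimit (α : ℕ → ℂ) (z : ℂ) : ℂ :=
  1 - ∑' m, α m * (z * (szegoPoly α m).eval z)

namespace ExpDecay

variable {α : ℕ → ℂ} {b A : ℝ}

lemma nonneg (h : ExpDecay α b A) : 0 ≤ A := by
  have := (norm_nonneg _).trans (h.bound 0)
  simpa using this

lemma summable_norm (h : ExpDecay α b A) : Summable fun n => ‖α n‖ :=
  Summable.of_nonneg_of_le (fun _ => norm_nonneg _) h.bound
    ((summable_geometric_of_lt_one h.pos.le h.lt_one).mul_left A)

lemma exists_bound (h : ExpDecay α b A) : ∃ M : ℝ, 1 ≤ M ∧ ∀ n (z : ℂ), ‖z‖ ≤ 1 →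
    ‖(szegoPoly α n).eval z‖ ≤ M ∧ ‖(szegoRev α n).eval z‖ ≤ M := by
  refine ⟨Real.exp (∑' n, ‖α n‖), Real.one_le_exp (tsum_nonneg fun _ => norm_nonneg _), ?_⟩
  intro n z hz
  have hle : ∏ i ∈ Finset.range n, (1 + ‖α i‖) ≤ Real.exp (∑' n, ‖α n‖) := by
    calc ∏ i ∈ Finset.range n, (1 + ‖α i‖) ≤ ∏ i ∈ Finset.range n, Real.exp ‖α i‖ := by
          refine Finset.prod_le_prod (fun i _ => by positivity) fun i _ => ?_
          rw [add_comm]; exact Real.add_one_le_exp _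
      _ = Real.exp (∑ i ∈ Finset.range n, ‖α i‖) := (Real.exp_sum _ _).symm
      _ ≤ _ := Real.exp_le_exp.2
          (h.summable_norm.sum_le_tsum _ fun _ _ => norm_nonneg _)
  have := norm_szego_le_prod α hz n
  exact ⟨this.1.trans hle, this.2.trans hle⟩

/-- A bound for `Φₙ` and `Φₙ*` on the closed unit disk. -/
noncomputable def supBound (h : ExpDecay α b A) : ℝ := h.exists_bound.choose

lemma one_le_supBound (h : ExpDecay α b A) : 1 ≤ h.supBound := h.exists_bound.choose_spec.1

lemma supBound_nonneg (h : ExpDecay α b A) : 0 ≤ h.supBound := zero_le_one.trans h.one_le_supBound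

lemma norm_szegoRev_le (h : ExpDecay α b A) (n : ℕ) {z : ℂ} (hz : ‖z‖ ≤ 1) :
    ‖(szegoRev α n).eval z‖ ≤ h.supBound := (h.exists_bound.choose_spec.2 n z hz).2

/-- Outside the disk, reflection reduces Φₙ to zⁿ times a value of Φₙ* inside the disk, where
`supBound` applies. -/
lemma norm_szegoPoly_le (h : ExpDecay α b A) (n : ℕ) {z : ℂ} {r : ℝ} (hr : 1 ≤ r)
    (hz : ‖z‖ ≤ r) : ‖(szegoPoly α n).eval z‖ ≤ h.supBound * r ^ n := by
  rcases le_total ‖z‖ 1 with h1 | h1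
  · exact (h.exists_bound.choose_spec.2 n z h1).1.trans
      (le_mul_of_one_le_right h.supBound_nonneg (one_le_pow₀ hr))
  · have hz0 : z ≠ 0 := by rintro rfl; simp at h1; linarith
    rw [(eval_szego_reflect α hz0 n).1, norm_mul, norm_pow, RCLike.norm_conj, mul_comm]
    gcongr
    · exact h.supBound_nonneg
    · apply h.norm_szegoRev_le
      simpa using inv_le_one_of_one_le₀ h1

/-- Growth rⁿ against decay bⁿ: this is where the radius 1/b of the continuation comes from. -/
lemma norm_term_le (h : ExpDecay α b A) (n : ℕ) {z : ℂ} {r : ℝ} (hr : 1 ≤ r)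
    (hz : ‖z‖ ≤ r) :
    ‖α n * (z * (szegoPoly α n).eval z)‖ ≤ A * h.supBound * r * (b * r) ^ n := by
  rw [norm_mul, norm_mul]
  calc ‖α n‖ * (‖z‖ * ‖(szegoPoly α n).eval z‖)
      ≤ (A * b ^ n) * (r * (h.supBound * r ^ n)) := by
        have := h.nonneg
        have := h.pos
        gcongr
        · exact h.bound n
        · exact h.norm_szegoPoly_le n hr hz
    _ = _ := by rw [mul_pow]; ring

lemma summable_bound (h : ExpDecay α b A) {r : ℝ} (hr : 1 ≤ r) (hbr : b * r < 1) (K : ℝ) :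
    Summable fun n : ℕ => K * (b * r) ^ n :=
  (summable_geometric_of_lt_one (by have := h.pos; positivity) hbr).mul_left _

lemma exists_radius (h : ExpDecay α b A) {z : ℂ} (hz : ‖z‖ < b⁻¹) :
    ∃ r, 1 ≤ r ∧ b * r < 1 ∧ ‖z‖ < r := by
  have h1 : 1 < b⁻¹ := (one_lt_inv₀ h.pos).2 h.lt_one
  obtain ⟨r, hr, hr'⟩ := exists_between (max_lt h1 hz)
  refine ⟨r, ((le_max_left _ _).trans_lt hr).le, ?_, (le_max_right _ _).trans_lt hr⟩
  have := mul_lt_mul_of_pos_left hr' h.pos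
  rwa [mul_inv_cancel₀ h.pos.ne'] at this

lemma summable_term (h : ExpDecay α b A) {z : ℂ} (hz : ‖z‖ < b⁻¹) :
    Summable fun n => α n * (z * (szegoPoly α n).eval z) := by
  obtain ⟨r, hr, hbr, hzr⟩ := h.exists_radius hz
  exact Summable.of_norm_bounded (h.summable_bound hr hbr _)
    fun n => h.norm_term_le n hr hzr.le

lemma szegoRev_eq_sum (α : ℕ → ℂ) (n : ℕ) (z : ℂ) : (szegoRev α n).eval z
    = 1 - ∑ m ∈ Finset.range n, α m * (z * (szegoPoly α m).eval z) := by
  induction n with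
  | zero => simp
  | succ n ih => rw [eval_szegoRev_succ, ih, Finset.sum_range_succ]; ring

lemma szegoRev_sub_szegoLimit (h : ExpDecay α b A) (n : ℕ) {z : ℂ} (hz : ‖z‖ < b⁻¹) :
    (szegoRev α n).eval z - szegoLimit α z
      = ∑' m, α (m + n) * (z * (szegoPoly α (m + n)).eval z) := by
  rw [szegoRev_eq_sum, szegoLimit, ← (h.summable_term hz).sum_add_tsum_nat_add n]
  ring

lemma tendsto_szegoRev (h : ExpDecay α b A) {z : ℂ} (hz : ‖z‖ < b⁻¹) :
    Tendsto (fun n => (szegoRev α n).eval z) atTop (𝓝 (szegoLimit α z)) := by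
  simp_rw [szegoRev_eq_sum]
  exact tendsto_const_nhds.sub (h.summable_term hz).hasSum.tendsto_sum_nat

lemma norm_lt_inv (h : ExpDecay α b A) {z : ℂ} (hz : ‖z‖ ≤ 1) : ‖z‖ < b⁻¹ :=
  hz.trans_lt ((one_lt_inv₀ h.pos).2 h.lt_one)

lemma norm_szegoLimit_le (h : ExpDecay α b A) {z : ℂ} (hz : ‖z‖ ≤ 1) :
    ‖szegoLimit α z‖ ≤ h.supBound :=
  le_of_tendsto (h.tendsto_szegoRev (h.norm_lt_inv hz)).norm
    (Eventually.of_forall fun n => h.norm_szegoRev_le n hz)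

lemma norm_szegoRev_sub_szegoLimit_le (h : ExpDecay α b A) (n : ℕ) {z : ℂ} (hz : ‖z‖ ≤ 1) :
    ‖(szegoRev α n).eval z - szegoLimit α z‖ ≤ A * h.supBound / (1 - b) * b ^ n := by
  rw [h.szegoRev_sub_szegoLimit n (h.norm_lt_inv hz)]
  have hs := (hasSum_geometric_of_lt_one h.pos.le h.lt_one).mul_left (A * h.supBound * b ^ n)
  refine (tsum_of_norm_bounded hs fun m => ?_).trans_eq (by ring)
  refine (h.norm_term_le (m + n) le_rfl hz).trans_eq ?_
  rw [mul_one, mul_one, pow_add]; ring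

lemma differentiableOn_szegoLimit (h : ExpDecay α b A) :
    DifferentiableOn ℂ (szegoLimit α) (Metric.ball 0 b⁻¹) := by
  intro z hz
  obtain ⟨r, hr, hbr, hzr⟩ := h.exists_radius (by simpa using hz)
  have : DifferentiableOn ℂ (szegoLimit α) (Metric.ball 0 r) := by
    refine (differentiableOn_const _).sub (Complex.differentiableOn_tsum_of_summable_norm
      (h.summable_bound hr hbr (A * h.supBound * r)) (fun n => ?_) Metric.isOpen_ball
      fun n w hw => h.norm_term_le n hr (by simpa using (Metric.mem_ball.1 hw).le))
    exact ((differentiable_id.mul (szegoPoly α n).differentiable).const_mul _).differentiableOn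
  exact (this.differentiableAt (Metric.isOpen_ball.mem_nhds (by simpa using hzr))).differentiableWithinAt

lemma analyticOnNhd_szegoLimit (h : ExpDecay α b A) :
    AnalyticOnNhd ℂ (szegoLimit α) (Metric.ball 0 b⁻¹) :=
  h.differentiableOn_szegoLimit.analyticOnNhd Metric.isOpen_ball

lemma differentiableAt_szegoLimit (h : ExpDecay α b A) {z : ℂ} (hz : ‖z‖ < b⁻¹) :
    DifferentiableAt ℂ (szegoLimit α) z :=
  h.differentiableOn_szegoLimit.differentiableAt (Metric.isOpen_ball.mem_nhds (by simpa using hz))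

@[simp] lemma _root_.OPUC.szegoLimit_zero (α : ℕ → ℂ) : szegoLimit α 0 = 1 := by simp [szegoLimit]

/-- The lower bounds ∏(1 - |α_i|) converge to a nonzero infinite product. The closed disk is
included, so division by F is possible on the circle itself. -/
lemma szegoLimit_ne_zero (h : ExpDecay α b A) (hα : ∀ n, ‖α n‖ < 1) {z : ℂ} (hz : ‖z‖ ≤ 1) :
    szegoLimit α z ≠ 0 := by
  have hs : Summable fun n => ‖-‖α n‖‖ := by simpa using h.summable_norm
  have hne : ∏' n, (1 + -‖α n‖) ≠ 0 :=
    tprod_one_add_ne_zero_of_summable (fun n => by linarith [hα n]) hs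
  have hm : Multipliable fun n => (1 + -‖α n‖) := multipliable_one_add_of_summable hs
  have hle : ∏' n, (1 + -‖α n‖) ≤ ‖szegoLimit α z‖ := by
    refine le_of_tendsto_of_tendsto' hm.hasProd.tendsto_prod_nat
      (h.tendsto_szegoRev (h.norm_lt_inv hz)).norm fun n => ?_
    simpa [sub_eq_add_neg] using prod_le_norm_szegoRev α (fun n => (hα n).le) hz n
  have h0 : 0 ≤ ∏' n, (1 + -‖α n‖) := by
    refine ge_of_tendsto' hm.hasProd.tendsto_prod_nat fun n => ?_
    exact Finset.prod_nonneg fun i _ => by linarith [hα i]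
  exact norm_pos_iff.1 ((lt_of_le_of_ne h0 hne.symm).trans_le hle)

end ExpDecay

/-! ### Expansion of the reflected polynomials in the annulus b < |z| ≤ 1. -/

/-- The terms of the remainder in the expansion of the reflected `Φₙ*` inside the unit disk. -/
noncomputable def remTerm (α : ℕ → ℂ) (c : ℂ) (b : ℝ) (m : ℕ) (z : ℂ) : ℂ :=
  (z⁻¹) ^ (m + 1) * ((conj (α m) - conj c * (b : ℂ) ^ m) * (szegoRev α m).eval z
    + conj c * (b : ℂ) ^ m * ((szegoRev α m).eval z - szegoLimit α z))

/-- The remainder in the expansion of the reflected `Φₙ*` inside the unit disk. -/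
noncomputable def remainder (α : ℕ → ℂ) (c : ℂ) (b : ℝ) (n : ℕ) (z : ℂ) : ℂ :=
  ∑' m, remTerm α c b (m + n) z

/-- Verblunsky coefficients with leading behaviour `c bⁿ` and error `O((bΔ)ⁿ)`, where the error
is normalized to be no better than `O(b²ⁿ)`. -/
structure LeadingDecay (α : ℕ → ℂ) (c : ℂ) (b Δ A : ℝ) : Prop extends ExpDecay α b A where
  le : b ≤ Δ
  rate_lt_one : Δ < 1
  error : ∀ n, ‖α n - c * (b : ℂ) ^ n‖ ≤ A * (b * Δ) ^ n

namespace LeadingDecay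

variable {α : ℕ → ℂ} {c : ℂ} {b Δ A : ℝ}

/-- The constant in the estimate of the remainder terms. -/
noncomputable def remConst (h : LeadingDecay α c b Δ A) : ℝ :=
  A * h.supBound + ‖c‖ * (A * h.supBound / (1 - b))

lemma rate_pos (h : LeadingDecay α c b Δ A) : 0 < Δ := h.pos.trans_le h.le

lemma remConst_nonneg (h : LeadingDecay α c b Δ A) : 0 ≤ h.remConst := by
  have := h.nonneg
  have := h.supBound_nonneg
  have := sub_pos.2 h.lt_one
  unfold remConst
  positivity

/-- There are two sources of error: α_m against c b^m, of size (bΔ)^m, and Φ_m* against its limit,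
of size b^m and multiplied by another b^m. The assumption b ≤ Δ puts b^{2m} below (bΔ)^m. -/
lemma norm_remTerm_le (h : LeadingDecay α c b Δ A) (m : ℕ) {z : ℂ} (hz1 : ‖z‖ ≤ 1) {ρ : ℝ}
    (hρ : 0 < ρ) (hz : ρ ≤ ‖z‖) :
    ‖remTerm α c b m z‖ ≤ h.remConst / ρ * (b * Δ / ρ) ^ m := by
  have hA := h.nonneg
  have hS := h.supBound_nonneg
  have hb := h.pos
  have hΔ := h.rate_pos
  have h1b := sub_pos.2 h.lt_one
  have h1 : ‖(conj (α m) - conj c * (b : ℂ) ^ m) * (szegoRev α m).eval z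
      + conj c * (b : ℂ) ^ m * ((szegoRev α m).eval z - szegoLimit α z)‖
      ≤ h.remConst * (b * Δ) ^ m := by
    have e1 : ‖conj (α m) - conj c * (b : ℂ) ^ m‖ ≤ A * (b * Δ) ^ m := by
      have : conj (α m) - conj c * (b : ℂ) ^ m = conj (α m - c * (b : ℂ) ^ m) := by simp
      rw [this, RCLike.norm_conj]; exact h.error m
    have e2 : ‖conj c * (b : ℂ) ^ m‖ = ‖c‖ * b ^ m := by simp [abs_of_pos hb]
    calc _ ≤ _ := norm_add_le _ _
      _ ≤ (A * (b * Δ) ^ m) * h.supBound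
          + ‖c‖ * b ^ m * (A * h.supBound / (1 - b) * b ^ m) := by
          rw [norm_mul, norm_mul (conj c * _), e2]
          gcongr
          · exact h.norm_szegoRev_le m hz1
          · exact h.norm_szegoRev_sub_szegoLimit_le m hz1
      _ ≤ (A * (b * Δ) ^ m) * h.supBound
          + ‖c‖ * b ^ m * (A * h.supBound / (1 - b) * Δ ^ m) := by
          gcongr; exact h.le
      _ = _ := by rw [remConst, mul_pow]; ring
  rw [remTerm, norm_mul, norm_pow, norm_inv]
  calc ‖z‖⁻¹ ^ (m + 1) * _ ≤ ρ⁻¹ ^ (m + 1) * (h.remConst * (b * Δ) ^ m) := by gcongr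
    _ = _ := by rw [div_pow, inv_pow, pow_succ]; field_simp

lemma summable_remTerm_bound (h : LeadingDecay α c b Δ A) {ρ : ℝ} (hρ : b * Δ < ρ) (n : ℕ) :
    Summable fun m => h.remConst / ρ * (b * Δ / ρ) ^ (m + n) := by
  have h0 : 0 < b * Δ := mul_pos h.pos h.rate_pos
  have hρ0 := h0.trans hρ
  refine Summable.mul_left _ ((summable_nat_add_iff n).2 ?_)
  exact summable_geometric_of_lt_one (by positivity) ((div_lt_one hρ0).2 hρ)

lemma norm_remainder_le (h : LeadingDecay α c b Δ A) (n : ℕ) {z : ℂ} (hz1 : ‖z‖ ≤ 1)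
    (hz : b * Δ < ‖z‖) :
    ‖remainder α c b n z‖ ≤ h.remConst / (‖z‖ - b * Δ) * (b * Δ / ‖z‖) ^ n := by
  have h0 : 0 < b * Δ := mul_pos h.pos h.rate_pos
  have hz0 := h0.trans hz
  have hs := (hasSum_geometric_of_lt_one (r := b * Δ / ‖z‖) (by positivity)
    ((div_lt_one hz0).2 hz)).mul_left (h.remConst / ‖z‖ * (b * Δ / ‖z‖) ^ n)
  refine (tsum_of_norm_bounded hs fun m => ?_).trans_eq ?_
  · refine (h.norm_remTerm_le (m + n) hz1 hz0 le_rfl).trans_eq ?_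
    rw [pow_add]; ring
  · have : ‖z‖ - b * Δ ≠ 0 := by linarith
    have h3 : 1 - b * Δ / ‖z‖ = (‖z‖ - b * Δ) / ‖z‖ := by field_simp
    rw [h3, inv_div]
    field_simp

lemma differentiableAt_remainder (h : LeadingDecay α c b Δ A) (n : ℕ) {z : ℂ} (hz1 : ‖z‖ < 1)
    (hz : b * Δ < ‖z‖) : DifferentiableAt ℂ (remainder α c b n) z := by
  obtain ⟨ρ, hρ, hρz⟩ := exists_between hz
  have h0 : 0 < b * Δ := mul_pos h.pos h.rate_pos
  have hρ0 := h0.trans hρ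
  set U : Set ℂ := {w | ρ < ‖w‖} ∩ {w | ‖w‖ < 1}
  have hU : IsOpen U := (isOpen_lt continuous_const continuous_norm).inter
    (isOpen_lt continuous_norm continuous_const)
  have : DifferentiableOn ℂ (remainder α c b n) U := by
    refine Complex.differentiableOn_tsum_of_summable_norm (h.summable_remTerm_bound hρ n) (fun m => ?_) hU
      fun m w hw => h.norm_remTerm_le (m + n) hw.2.le hρ0 hw.1.le
    intro w hw
    have hw0 : w ≠ 0 := norm_pos_iff.1 (hρ0.trans hw.1)
    have hF := h.differentiableAt_szegoLimit (h.norm_lt_inv hw.2.le)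
    have hQ := (szegoRev α (m + n)).differentiableAt (x := w)
    have hi := differentiableAt_inv (𝕜 := ℂ) hw0
    exact (((hi.pow (m + n + 1)).mul ((hQ.const_mul _).add
      ((hQ.sub hF).const_mul _)))).differentiableWithinAt
  exact this.differentiableAt (hU.mem_nhds ⟨hρz, hz1⟩)

/-- Expansion of the reflected `Φₙ*` in the annulus `b < |z| ≤ 1`. -/
theorem conj_szegoRev_eq (h : LeadingDecay α c b Δ A) (n : ℕ) {z : ℂ} (hz1 : ‖z‖ ≤ 1)
    (hz : b < ‖z‖) :
    conj ((szegoRev α n).eval (1 / conj z))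
      = conj (szegoLimit α (1 / conj z))
        + (b / z) ^ n * (conj c * szegoLimit α z / (z - b)) + remainder α c b n z := by
  have hb := h.pos
  have hz0 : z ≠ 0 := norm_pos_iff.1 (hb.trans hz)
  have hu : ‖1 / conj z‖ < b⁻¹ := by
    rw [norm_div, norm_one, RCLike.norm_conj, one_div]
    exact inv_strictAnti₀ hb hz
  have hbΔ : b * Δ < ‖z‖ := by nlinarith [h.rate_lt_one]
  have h1 := congrArg conj (h.szegoRev_sub_szegoLimit n hu)
  rw [map_sub, Complex.conj_tsum] at h1
  have hgeo : HasSum (fun m : ℕ => conj c * (b : ℂ) ^ (m + n) * szegoLimit α z * (z⁻¹) ^ (m + n + 1))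
      ((b / z) ^ n * (conj c * szegoLimit α z / (z - b))) := by
    have hlt : ‖(b : ℂ) / z‖ < 1 := by
      rw [norm_div, Complex.norm_real, Real.norm_of_nonneg hb.le]
      exact (div_lt_one (hb.trans hz)).2 hz
    have hzb : z - b ≠ 0 := by
      intro h0
      rw [sub_eq_zero.1 h0, Complex.norm_real, Real.norm_of_nonneg hb.le] at hz
      exact lt_irrefl _ hz
    convert! (hasSum_geometric_of_norm_lt_one hlt).mul_left
      (conj c * szegoLimit α z * (b / z) ^ n * z⁻¹) using 1
    · ext m
      rw [pow_add, pow_succ, div_pow, div_pow, inv_pow, pow_add]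
      field_simp
    · have : 1 - (b : ℂ) / z = (z - b) / z := by field_simp
      rw [this, inv_div]
      field_simp
  have hrem : Summable fun m => remTerm α c b (m + n) z :=
    Summable.of_norm_bounded (h.summable_remTerm_bound hbΔ n)
      fun m => h.norm_remTerm_le (m + n) hz1 (hb.trans hz) le_rfl
  -- By reflection, each tail term is z^{-(m+n+1)} conj(α_{m+n}) Φ*_{m+n}(z), which splits exactly
  -- into the geometric term and `remTerm`.
  have hsum : (∑' m, conj (α (m + n) * (1 / conj z * (szegoPoly α (m + n)).eval (1 / conj z))))
      = (b / z) ^ n * (conj c * szegoLimit α z / (z - b)) + remainder α c b n z := by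
    rw [← hgeo.tsum_eq, remainder, ← hgeo.summable.tsum_add hrem]
    congr 1
    ext m
    have hu0 : 1 / conj z ≠ 0 := by simpa using hz0
    rw [(eval_szego_reflect α hu0 (m + n)).1, remTerm]
    simp only [map_mul, map_div₀, map_one, Complex.conj_conj, map_pow, one_div_one_div]
    ring
  rw [hsum] at h1
  linear_combination h1

end LeadingDecay

end OPUC

/-! ### The reflected limit and its zeros near the circle |z| = b. -/

namespace OPUC

namespace LeadingDecay

variable {α : ℕ → ℂ} {c : ℂ} {b Δ A : ℝ}

lemma norm_one_div_conj (z : ℂ) : ‖1 / conj z‖ = ‖z‖⁻¹ := by simp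

lemma differentiableAt_conj_szegoLimit (h : LeadingDecay α c b Δ A) {z : ℂ} (hz : b < ‖z‖) :
    DifferentiableAt ℂ (fun z => conj (szegoLimit α (1 / conj z))) z := by
  have hz0 : z ≠ 0 := norm_pos_iff.1 (h.pos.trans hz)
  have hF : DifferentiableAt ℂ (conj ∘ szegoLimit α ∘ conj) (1 / z) := by
    rw [differentiableAt_conj_conj_iff]
    apply h.differentiableAt_szegoLimit
    rw [RCLike.norm_conj, norm_div, norm_one, one_div]
    exact inv_strictAnti₀ h.pos hz
  have hi : DifferentiableAt ℂ (fun z : ℂ => 1 / z) z :=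
    (differentiableAt_const 1).div differentiableAt_id hz0
  have := DifferentiableAt.comp z hF hi
  convert! this using 1
  ext w
  simp

/-- This is the expansion for n = 0, where Φ₀* = 1, cleared of the pole at b. The right side makes
sense and is analytic for bΔ < |z| < 1, so it continues the left side across |z| = b. -/
lemma mul_conj_szegoLimit_eq (h : LeadingDecay α c b Δ A) {z : ℂ} (hz1 : ‖z‖ ≤ 1)
    (hz : b < ‖z‖) :
    (z - b) * conj (szegoLimit α (1 / conj z))
      = (z - b) * (1 - remainder α c b 0 z) - conj c * szegoLimit α z := by
  have h0 := h.conj_szegoRev_eq 0 hz1 hz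
  have hzb : z - b ≠ 0 := by
    intro h0
    rw [sub_eq_zero.1 h0, Complex.norm_real, Real.norm_of_nonneg h.pos.le] at hz
    exact lt_irrefl _ hz
  simp only [szegoRev_zero, eval_one, map_one, pow_zero, one_mul] at h0
  field_simp at h0
  linear_combination -h0

/-- Local vanishing would propagate by the identity theorem to the origin, where the limit equals 1.
-/
lemma not_eventually_conj_szegoLimit_eq_zero (h : LeadingDecay α c b Δ A) {z : ℂ}
    (hz : b < ‖z‖) : ¬ ∀ᶠ w in 𝓝 z, conj (szegoLimit α (1 / conj w)) = 0 := by
  intro h0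
  have hz0 : z ≠ 0 := norm_pos_iff.1 (h.pos.trans hz)
  have hcont : Tendsto (fun v : ℂ => 1 / conj v) (𝓝 (1 / conj z)) (𝓝 z) := by
    have h1 : ContinuousAt (fun v : ℂ => 1 / conj v) (1 / conj z) :=
      continuousAt_const.div Complex.continuous_conj.continuousAt (by simpa using hz0)
    simpa [ContinuousAt] using h1
  have h1 : szegoLimit α =ᶠ[𝓝 (1 / conj z)] 0 := by
    filter_upwards [hcont.eventually h0] with v hv
    simpa using hv
  have hball : 1 / conj z ∈ Metric.ball (0 : ℂ) b⁻¹ := by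
    rw [mem_ball_zero_iff, norm_one_div_conj]
    exact inv_strictAnti₀ h.pos hz
  have h2 := h.analyticOnNhd_szegoLimit.eqOn_zero_of_preconnected_of_eventuallyEq_zero
    (convex_ball _ _).isPreconnected hball h1
    (Metric.mem_ball_self (inv_pos.2 h.pos))
  simp at h2

/-- The zeros of the reflected Szegő limit do not accumulate at the circle `|z| = b`, because
the limit is meromorphic across that circle. -/
theorem exists_radius_le_of_zero (h : LeadingDecay α c b Δ A) : ∃ r, b < r ∧ ∀ z : ℂ,
    b < ‖z‖ → ‖z‖ < 1 → conj (szegoLimit α (1 / conj z)) = 0 → r ≤ ‖z‖ := by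
  by_contra! hcon
  have hlt (n : ℕ) : b < b + 1 / ((n : ℝ) + 1) := by
    have : 0 < 1 / ((n : ℝ) + 1) := by positivity
    linarith
  choose z hbz hz1 hz0 hzr using fun n : ℕ => hcon (b + 1 / ((n : ℝ) + 1)) (hlt n)
  -- Zeros with moduli decreasing to b would accumulate at a point w of the circle |w| = b, where
  -- the continued function `H` is analytic.
  obtain ⟨w, -, φ, hφ, hw⟩ := (isCompact_closedBall (0 : ℂ) 1).tendsto_subseq
    (x := z) (fun n => by simpa using (hz1 n).le)
  have hnorm : ‖w‖ = b := by
    have h1 : Tendsto (fun n => ‖z (φ n)‖) atTop (𝓝 ‖w‖) := hw.norm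
    have h2 : Tendsto (fun n : ℕ => b + 1 / ((n : ℝ) + 1)) atTop (𝓝 b) := by
      simpa using tendsto_one_div_add_atTop_nhds_zero_nat.const_add b
    exact tendsto_nhds_unique h1 (tendsto_of_tendsto_of_tendsto_of_le_of_le tendsto_const_nhds
      (h2.comp hφ.tendsto_atTop) (fun n => (hbz _).le) fun n => (hzr _).le)
  set H : ℂ → ℂ := fun z => (z - b) * (1 - remainder α c b 0 z) - conj c * szegoLimit α z with hH
  have hbΔ : b * Δ < b := by nlinarith [h.rate_lt_one, h.pos]
  have hb1 := h.lt_one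
  have hHan : AnalyticAt ℂ H w := by
    rw [Complex.analyticAt_iff_eventually_differentiableAt]
    have hU : IsOpen ({v : ℂ | b * Δ < ‖v‖} ∩ {v | ‖v‖ < 1}) :=
      (isOpen_lt continuous_const continuous_norm).inter
        (isOpen_lt continuous_norm continuous_const)
    filter_upwards [hU.mem_nhds (x := w) ⟨by simpa [hnorm] using hbΔ, by simpa [hnorm] using hb1⟩]
      with v hv
    have h1 := h.differentiableAt_remainder 0 hv.2 hv.1
    have h2 := h.differentiableAt_szegoLimit (h.norm_lt_inv hv.2.le)
    exact ((differentiableAt_id.sub_const _).mul (h1.const_sub 1)).sub (h2.const_mul _)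
  rcases hHan.eventually_eq_zero_or_eventually_ne_zero with h0 | h0
  -- If `H` vanished near w, moving w slightly outward along its ray would reach a point of the
  -- annulus near which the reflected limit vanishes identically.
  · have ht : Tendsto (fun t : ℝ => (t : ℂ) * w) (𝓝[>] 1) (𝓝 w) := by
      have : Continuous fun t : ℝ => (t : ℂ) * w := by fun_prop
      have := this.tendsto 1
      simp only [Complex.ofReal_one, one_mul] at this
      exact this.mono_left nhdsWithin_le_nhds
    have hlt1 : ∀ᶠ v in 𝓝 w, ‖v‖ < 1 :=
      (isOpen_lt continuous_norm continuous_const).mem_nhds (by simpa [hnorm] using hb1)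
    obtain ⟨t, ht1, ht2, ht3⟩ := ((ht.eventually h0.eventually_nhds).and
      ((ht.eventually hlt1).and self_mem_nhdsWithin)).exists
    have htb : b < ‖(t : ℂ) * w‖ := by
      have ht3' : (1 : ℝ) < t := ht3
      rw [norm_mul, hnorm, Complex.norm_real, Real.norm_of_nonneg (by linarith)]
      nlinarith [h.pos]
    refine h.not_eventually_conj_szegoLimit_eq_zero htb ?_
    have hU : IsOpen ({v : ℂ | b < ‖v‖} ∩ {v | ‖v‖ < 1}) :=
      (isOpen_lt continuous_const continuous_norm).inter
        (isOpen_lt continuous_norm continuous_const)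
    filter_upwards [ht1, hU.mem_nhds ⟨htb, ht2⟩] with v hv hvU
    have := h.mul_conj_szegoLimit_eq hvU.2.le hvU.1
    rw [show (v - b) * (1 - remainder α c b 0 v) - conj c * szegoLimit α v = 0 from hv] at this
    refine (mul_eq_zero.1 this).resolve_left fun hvb => ?_
    have hvb' := hvU.1
    simp only [Set.mem_ofPred_eq] at hvb'
    rw [sub_eq_zero.1 hvb, Complex.norm_real, Real.norm_of_nonneg h.pos.le] at hvb'
    exact lt_irrefl _ hvb'
  -- Otherwise w is isolated from other zeros of `H`, yet the given zeros, all of modulus above b,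
  -- tend to w without meeting it.
  · have hw' : Tendsto (z ∘ φ) atTop (𝓝[≠] w) := by
      refine tendsto_nhdsWithin_iff.2 ⟨hw, Eventually.of_forall fun n heq => ?_⟩
      have := hbz (φ n)
      rw [show z (φ n) = w from heq, hnorm] at this
      exact lt_irrefl _ this
    obtain ⟨n, hn⟩ := (hw'.eventually h0).exists
    apply hn
    simp only [hH, Function.comp]
    rw [← h.mul_conj_szegoLimit_eq (hz1 _).le (hbz _), hz0, mul_zero]

end LeadingDecay

end OPUC

/-! ### Perturbed roots of unity. -/

namespace OPUC

/-- The principal branch of the `k`-th root of `1 + x`. -/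
noncomputable def rootOneAdd (k : ℕ) (x : ℂ) : ℂ := (1 + x) ^ ((k : ℂ)⁻¹)

lemma rootOneAdd_pow {k : ℕ} (hk : k ≠ 0) (x : ℂ) : rootOneAdd k x ^ k = 1 + x :=
  Complex.cpow_nat_inv_pow _ hk

@[simp] lemma rootOneAdd_zero (k : ℕ) : rootOneAdd k 0 = 1 := by simp [rootOneAdd]

lemma half_le_norm_one_add {x : ℂ} (hx : ‖x‖ ≤ 1 / 2) : 1 / 2 ≤ ‖1 + x‖ := by
  have := norm_sub_le_norm_add (1 : ℂ) x
  rw [norm_one] at this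
  linarith

/-- The derivative carries the exponent 1/k - 1 in (-1, 0], and |1 + w| ≥ 1/2, so 2 bounds it for
every k. -/
lemma norm_rootOneAdd_sub_le {k : ℕ} (hk : 1 ≤ k) {x y : ℂ} (hx : ‖x‖ ≤ 1 / 2)
    (hy : ‖y‖ ≤ 1 / 2) : ‖rootOneAdd k x - rootOneAdd k y‖ ≤ 2 * ‖x - y‖ := by
  have hk0 : (0 : ℝ) < k := by exact_mod_cast hk
  have hkinv : (k : ℝ)⁻¹ ≤ 1 := inv_le_one_of_one_le₀ (by exact_mod_cast hk)
  have hslit (w : ℂ) (hw : w ∈ Metric.closedBall (0 : ℂ) (1 / 2)) : 1 + w ∈ Complex.slitPlane := by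
    left
    have h1 := (abs_le.1 (Complex.abs_re_le_norm w)).1
    have h2 : ‖w‖ ≤ 1 / 2 := by simpa using hw
    simp
    linarith
  have hderiv (w : ℂ) (hw : w ∈ Metric.closedBall (0 : ℂ) (1 / 2)) :
      HasDerivWithinAt (rootOneAdd k) ((k : ℂ)⁻¹ * (1 + w) ^ ((k : ℂ)⁻¹ - 1) * 1)
        (Metric.closedBall (0 : ℂ) (1 / 2)) w :=
    (((hasDerivAt_id w).const_add 1).cpow_const (hslit w hw)).hasDerivWithinAt
  have hbound (w : ℂ) (hw : w ∈ Metric.closedBall (0 : ℂ) (1 / 2)) :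
      ‖(k : ℂ)⁻¹ * (1 + w) ^ ((k : ℂ)⁻¹ - 1) * 1‖ ≤ 2 := by
    have hw' : ‖w‖ ≤ 1 / 2 := by simpa using hw
    have h1 := half_le_norm_one_add hw'
    have h2 : ((k : ℂ)⁻¹ - 1) = (((k : ℝ)⁻¹ - 1 : ℝ) : ℂ) := by push_cast; rfl
    rw [mul_one, norm_mul, h2, Complex.norm_cpow_real, norm_inv, Complex.norm_natCast]
    have h3 : ‖1 + w‖ ^ ((k : ℝ)⁻¹ - 1) ≤ 2 := by
      calc ‖1 + w‖ ^ ((k : ℝ)⁻¹ - 1) ≤ (1 / 2 : ℝ) ^ ((k : ℝ)⁻¹ - 1) :=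
            Real.rpow_le_rpow_of_nonpos (by norm_num) h1 (by linarith)
        _ ≤ (1 / 2 : ℝ) ^ (-1 : ℝ) := by
            apply Real.rpow_le_rpow_of_exponent_ge (by norm_num) (by norm_num)
            have : 0 < (k : ℝ)⁻¹ := by positivity
            linarith
        _ = 2 := by rw [Real.rpow_neg_one]; norm_num
    calc (k : ℝ)⁻¹ * ‖1 + w‖ ^ ((k : ℝ)⁻¹ - 1) ≤ 1 * 2 := by gcongr
      _ = 2 := one_mul 2
  exact (convex_closedBall (0 : ℂ) (1 / 2)).norm_image_sub_le_of_norm_hasDerivWithin_le hderiv hbound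
    (by simpa using hy) (by simpa using hx)

/-- The `k`-th root of unity `e^{2πij/k}`. -/
noncomputable def unityRoot (k j : ℕ) : ℂ :=
  Complex.exp (2 * (Real.pi : ℂ) * Complex.I * (j : ℂ) / (k : ℂ))

lemma unityRoot_eq_pow (k j : ℕ) :
    unityRoot k j = Complex.exp (2 * Real.pi * Complex.I / k) ^ j := by
  rw [unityRoot, ← Complex.exp_nat_mul]
  congr 1; ring

@[simp] lemma norm_unityRoot (k j : ℕ) : ‖unityRoot k j‖ = 1 := by
  have : 2 * (Real.pi : ℂ) * Complex.I * (j : ℂ) / (k : ℂ)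
      = ((2 * Real.pi * j / k : ℝ) : ℂ) * Complex.I := by push_cast; ring
  rw [unityRoot, this, Complex.norm_exp_ofReal_mul_I]

lemma unityRoot_pow {k : ℕ} (hk : k ≠ 0) (j : ℕ) : unityRoot k j ^ k = 1 := by
  rw [unityRoot_eq_pow, pow_right_comm, (Complex.isPrimitiveRoot_exp k hk).pow_eq_one,
    one_pow]

lemma unityRoot_injective {k : ℕ} (hk : k ≠ 0) :
    Function.Injective fun j : Fin k => unityRoot k j := by
  intro i j hij
  simp only [unityRoot_eq_pow] at hij
  exact Fin.ext ((Complex.isPrimitiveRoot_exp k hk).pow_inj i.2 j.2 hij)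

lemma exists_unityRoot_eq {k : ℕ} (hk : k ≠ 0) {x : ℂ} (hx : x ^ k = 1) :
    ∃ j : Fin k, x = unityRoot k j := by
  have : NeZero k := ⟨hk⟩
  obtain ⟨j, hj, h⟩ := (Complex.isPrimitiveRoot_exp k hk).eq_pow_of_pow_eq_one hx
  exact ⟨⟨j, hj⟩, by rw [unityRoot_eq_pow, h]⟩

/-- Solutions of `v ^ k = 1 + τ v` for a small analytic perturbation `τ`: in the disk of radius
`2` there are exactly `k` of them, they are simple, and they are close to the `k`-th roots of
unity. -/
theorem exists_roots_of_perturbation {k : ℕ} (hk : 1 ≤ k) {τ : ℂ → ℂ} {σ : ℝ}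
    (hσ : σ ≤ 1 / 8) (hτ : DifferentiableOn ℂ τ (Metric.ball 0 4))
    (hτσ : ∀ v ∈ Metric.ball (0 : ℂ) 4, ‖τ v‖ ≤ σ) :
    ∃ v : Fin k → ℂ, Function.Injective v ∧ (∀ j, ‖v j - unityRoot k j‖ ≤ 2 * σ) ∧
      (∀ x ∈ Metric.ball (0 : ℂ) 2, x ^ k = 1 + τ x ↔ ∃ j, x = v j) ∧
      (∀ x ∈ Metric.ball (0 : ℂ) 2, x ^ k = 1 + τ x → k * x ^ (k - 1) ≠ deriv τ x) := by
  have hk0 : k ≠ 0 := by omega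
  have hsub : Metric.ball (0 : ℂ) 2 ⊆ Metric.ball 0 4 := Metric.ball_subset_ball (by norm_num)
  have hσ0 : 0 ≤ σ := (norm_nonneg _).trans (hτσ 0 (by simp))
  have hτ2 (x : ℂ) (hx : x ∈ Metric.ball (0 : ℂ) 2) : ‖τ x‖ ≤ 1 / 2 :=
    (hτσ x (hsub hx)).trans (by linarith)
  -- Cauchy's estimate on unit disks centred in the disk of radius 2; these remain inside the disk
  -- of radius 4.
  have hderiv (x : ℂ) (hx : x ∈ Metric.ball (0 : ℂ) 2) : ‖deriv τ x‖ ≤ σ := by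
    have hcl : Metric.closedBall x 1 ⊆ Metric.ball (0 : ℂ) 4 := by
      apply Metric.closedBall_subset_ball'
      have := Metric.mem_ball.1 hx
      linarith
    have := Complex.norm_deriv_le_of_forall_mem_sphere_norm_le (f := τ) (c := x) (C := σ) one_pos
      (hτ.diffContOnCl_ball hcl)
      (fun z hz => hτσ z (hcl (Metric.sphere_subset_closedBall hz)))
    simpa using this
  have hlip (x y : ℂ) (hx : x ∈ Metric.ball (0 : ℂ) 2) (hy : y ∈ Metric.ball (0 : ℂ) 2) :
      ‖τ x - τ y‖ ≤ σ * ‖x - y‖ :=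
    (convex_ball (0 : ℂ) 2).norm_image_sub_le_of_norm_deriv_le
      (fun w hw => hτ.differentiableAt (Metric.isOpen_ball.mem_nhds (hsub hw))) hderiv hy hx
  -- Extracting a k-th root turns v^k = 1 + τ(v) into k fixed-point problems, one per root of unity.
  -- Each map is a contraction with factor 2 · (1/8) ≤ 1/2.
  set T : ℕ → ℂ → ℂ := fun j x => unityRoot k j * rootOneAdd k (τ x) with hT
  have hTlip (j : ℕ) (x y : ℂ) (hx : x ∈ Metric.ball (0 : ℂ) 2)
      (hy : y ∈ Metric.ball (0 : ℂ) 2) : ‖T j x - T j y‖ ≤ 1 / 2 * ‖x - y‖ := by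
    rw [hT]
    simp only
    rw [← mul_sub, norm_mul, norm_unityRoot, one_mul]
    have h1 := norm_rootOneAdd_sub_le hk (hτ2 x hx) (hτ2 y hy)
    have h2 := hlip x y hx hy
    nlinarith [norm_nonneg (x - y)]
  have hTσ (j : ℕ) (x : ℂ) (hx : x ∈ Metric.ball (0 : ℂ) 2) :
      ‖T j x - unityRoot k j‖ ≤ 2 * σ := by
    have h1 := norm_rootOneAdd_sub_le hk (hτ2 x hx) (y := 0) (by simp)
    rw [rootOneAdd_zero, sub_zero] at h1
    have : T j x - unityRoot k j = unityRoot k j * (rootOneAdd k (τ x) - 1) := by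
      simp only [hT]; ring
    rw [this, norm_mul, norm_unityRoot, one_mul]
    linarith [hτσ x (hsub hx)]
  have hball : Metric.closedBall (0 : ℂ) (3 / 2) ⊆ Metric.ball 0 2 :=
    Metric.closedBall_subset_ball (by norm_num)
  have hmaps (j : ℕ) : Set.MapsTo (T j) (Metric.closedBall (0 : ℂ) (3 / 2))
      (Metric.closedBall (0 : ℂ) (3 / 2)) := by
    intro x hx
    have h1 := hTσ j x (hball hx)
    have h2 := norm_sub_norm_le (T j x) (unityRoot k j)
    rw [norm_unityRoot] at h2
    rw [mem_closedBall_zero_iff]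
    linarith
  have hfix (j : ℕ) : ∃ x ∈ Metric.ball (0 : ℂ) 2, T j x = x := by
    have hc : ContractingWith (1 / 2) ((hmaps j).restrict (T j) _ _) := by
      refine ⟨by rw [← NNReal.coe_lt_coe]; norm_num, LipschitzWith.of_dist_le_mul fun x y => ?_⟩
      rw [Subtype.dist_eq, Subtype.dist_eq, dist_eq_norm, dist_eq_norm]
      simpa using hTlip j x y (hball x.2) (hball y.2)
    obtain ⟨x, hx, hfx, -⟩ := hc.exists_fixedPoint' (Metric.isClosed_closedBall.isComplete)
      (hmaps j) (x := 0) (by simp; norm_num) (edist_ne_top _ _)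
    exact ⟨x, hball hx, hfx⟩
  choose v hv2 hvT using hfix
  have huniq (j : ℕ) (x : ℂ) (hx : x ∈ Metric.ball (0 : ℂ) 2) (hxT : T j x = x) : x = v j := by
    have := hTlip j x (v j) hx (hv2 j)
    rw [hxT, hvT] at this
    have h0 : ‖x - v j‖ ≤ 0 := by linarith [norm_nonneg (x - v j)]
    exact sub_eq_zero.1 (norm_le_zero_iff.1 h0)
  have hroot0 (x : ℂ) (hx : x ∈ Metric.ball (0 : ℂ) 2) : rootOneAdd k (τ x) ≠ 0 := by
    intro h0
    have h1 := rootOneAdd_pow hk0 (τ x)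
    rw [h0, zero_pow hk0] at h1
    have h2 := half_le_norm_one_add (hτ2 x hx)
    rw [← h1, norm_zero] at h2
    linarith
  refine ⟨fun j => v j, ?_, fun j => ?_, fun x hx => ⟨fun h => ?_, ?_⟩, fun x hx h heq => ?_⟩
  · intro i j (hij : v i = v j)
    have h1 : T i (v i) = T j (v i) := by rw [hvT, hij, hvT]
    exact unityRoot_injective hk0 (mul_right_cancel₀ (hroot0 _ (hv2 _)) h1)
  · have := hTσ j (v j) (hv2 j)
    rwa [hvT] at this
  · have hr := hroot0 x hx
    obtain ⟨j, hj⟩ := exists_unityRoot_eq hk0 (x := x / rootOneAdd k (τ x))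
      (by rw [div_pow, rootOneAdd_pow hk0, h, div_self]; rw [← rootOneAdd_pow hk0]; exact pow_ne_zero _ hr)
    refine ⟨j, huniq j x hx ?_⟩
    rw [hT]
    simp only
    rw [← hj, div_mul_cancel₀ _ hr]
  · rintro ⟨j, rfl⟩
    have h1 : v j ^ k = (T j (v j)) ^ k := by rw [hvT]
    rw [h1, hT]
    simp only
    rw [mul_pow, unityRoot_pow hk0, one_mul, rootOneAdd_pow hk0]
  -- Simplicity: at a root |x|^k ≥ 1/2 and |x| < 2, so k|x|^{k-1} > 1/4, while |τ'(x)| ≤ 1/8.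
  · have h1 := half_le_norm_one_add (hτ2 x hx)
    have hx2 : ‖x‖ < 2 := by simpa using hx
    have h2 : ‖x‖ ^ k = ‖1 + τ x‖ := by rw [← h, norm_pow]
    have h3 : ‖x‖ ^ k = ‖x‖ ^ (k - 1) * ‖x‖ := by
      rw [← pow_succ]; congr 1; omega
    have h4 : ‖deriv τ x‖ = k * ‖x‖ ^ (k - 1) := by
      rw [← heq, norm_mul, norm_pow, Complex.norm_natCast]
    have h5 := hderiv x hx
    have h6 : (1 : ℝ) ≤ k := by exact_mod_cast hk
    have h7 : 0 ≤ ‖x‖ ^ (k - 1) := by positivity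
    nlinarith

end OPUC

/-! ### Moments of measures on the circle, and arc length. -/

namespace OPUC

section Moments

variable {μ ν : Measure ℂ}

lemma integral_pow_mul_conj_pow_eq [IsFiniteMeasure μ] [IsFiniteMeasure ν]
    (hμ : μ (Metric.sphere (0 : ℂ) 1)ᶜ = 0) (hν : ν (Metric.sphere (0 : ℂ) 1)ᶜ = 0)
    (h : ∀ j : ℕ, ∫ z, z ^ j ∂μ = ∫ z, z ^ j ∂ν) (a b : ℕ) :
    ∫ z, z ^ a * conj z ^ b ∂μ = ∫ z, z ^ a * conj z ^ b ∂ν := by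
  have key {ρ : Measure ℂ} (hρ : ρ (Metric.sphere (0 : ℂ) 1)ᶜ = 0) :
      ∫ z, z ^ a * conj z ^ b ∂ρ
        = if b ≤ a then ∫ z, z ^ (a - b) ∂ρ else conj (∫ z, z ^ (b - a) ∂ρ) := by
    split_ifs with hab
    · apply integral_congr_ae
      filter_upwards [ae_norm_eq_one hρ] with z hz
      have h1 : z * conj z = 1 := by rw [Complex.mul_conj', hz]; simp
      calc z ^ a * conj z ^ b = z ^ (a - b) * (z * conj z) ^ b := by
            rw [mul_pow, ← mul_assoc, ← pow_add, Nat.sub_add_cancel hab]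
        _ = _ := by rw [h1]; simp
    · rw [← integral_conj]
      apply integral_congr_ae
      filter_upwards [ae_norm_eq_one hρ] with z hz
      have h1 : z * conj z = 1 := by rw [Complex.mul_conj', hz]; simp
      calc z ^ a * conj z ^ b = (z * conj z) ^ a * conj z ^ (b - a) := by
            rw [mul_pow, mul_assoc, ← pow_add, Nat.add_sub_cancel' (by omega)]
        _ = _ := by rw [h1]; simp
  rw [key hμ, key hν, h, h]

/-- The inner product is bounded by |t| on the circle, so the exponential series may be integrated
termwise. Expanding each power in z and z̄ shows that mixed moments determine the characteristic
function. -/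
lemma charFun_eq_tsum [IsFiniteMeasure μ] (hμ : μ (Metric.sphere (0 : ℂ) 1)ᶜ = 0) (t : ℂ) :
    charFun μ t = ∑' n : ℕ, ((n.factorial : ℂ)⁻¹ * (Complex.I / 2) ^ n) *
      ∑ i ∈ Finset.range (n + 1),
        (conj t ^ i * t ^ (n - i) * (n.choose i : ℂ)) * ∫ z, z ^ i * conj z ^ (n - i) ∂μ := by
  have hcont (i j : ℕ) : Continuous fun z : ℂ => z ^ i * conj z ^ j :=
    (continuous_pow i).mul (Complex.continuous_conj.pow j)
  set f : ℕ → ℂ → ℂ := fun n z =>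
    (n.factorial : ℂ)⁻¹ * (((inner ℝ z t : ℝ) : ℂ) * Complex.I) ^ n with hf
  have hfc (n : ℕ) : Continuous (f n) := by fun_prop
  have hint (n : ℕ) : Integrable (f n) μ :=
    integrable_of_continuousOn_sphere hμ (hfc n).continuousOn
  have hnorm (n : ℕ) : ∫ z, ‖f n z‖ ∂μ ≤ (‖t‖ ^ n / n.factorial) * μ.real Set.univ := by
    have : ∫ z, ‖f n z‖ ∂μ ≤ ∫ _, ‖t‖ ^ n / n.factorial ∂μ := by
      refine integral_mono_ae (hint n).norm (integrable_const _) ?_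
      filter_upwards [ae_norm_eq_one hμ] with z hz
      have h1 : |inner ℝ z t| ≤ ‖t‖ := by
        simpa [hz] using abs_real_inner_le_norm z t
      rw [hf]
      simp only [norm_mul, norm_inv, Complex.norm_natCast, norm_pow, Complex.norm_real,
        Complex.norm_I, mul_one, Real.norm_eq_abs]
      rw [div_eq_inv_mul]
      gcongr
    rwa [integral_const, smul_eq_mul, mul_comm] at this
  have hsum : Summable fun n => ∫ z, ‖f n z‖ ∂μ :=
    Summable.of_nonneg_of_le (fun n => integral_nonneg fun _ => norm_nonneg _) hnorm
      ((Real.summable_pow_div_factorial ‖t‖).mul_right _)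
  have h := (hasSum_integral_of_summable_integral_norm hint hsum).tsum_eq
  rw [charFun_apply]
  have hexp : ∫ z, ∑' n, f n z ∂μ = ∫ z, Complex.exp ((inner ℝ z t : ℝ) * Complex.I) ∂μ := by
    congr 1
    ext z
    rw [Complex.exp_eq_exp_ℂ, NormedSpace.exp_eq_tsum_div]
    congr 1; ext n; rw [hf]; simp only; ring
  rw [← hexp, ← h]
  congr 1
  ext n
  have hexpand (z : ℂ) : f n z = ∑ i ∈ Finset.range (n + 1),
      ((n.factorial : ℂ)⁻¹ * (Complex.I / 2) ^ n * (conj t ^ i * t ^ (n - i) * (n.choose i : ℂ)))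
        * (z ^ i * conj z ^ (n - i)) := by
    have hin : ((inner ℝ z t : ℝ) : ℂ) * Complex.I
        = (Complex.I / 2) * (z * conj t + conj z * t) := by
      rw [Complex.inner]
      have := Complex.add_conj (conj z * t)
      rw [map_mul, Complex.conj_conj] at this
      rw [show z * conj t + conj z * t = conj z * t + z * conj t by ring, this]
      push_cast; ring_nf
    rw [hf]
    simp only
    rw [hin, mul_pow, add_pow, Finset.mul_sum, Finset.mul_sum]
    refine Finset.sum_congr rfl fun i _ => ?_
    rw [mul_pow, mul_pow]; ring
  simp_rw [hexpand]
  rw [integral_finsetSum _ fun i _ =>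
    (integrable_of_continuousOn_sphere hμ (hcont i (n - i)).continuousOn).const_mul _,
    Finset.mul_sum]
  refine Finset.sum_congr rfl fun i _ => ?_
  rw [integral_const_mul]; ring

/-- Finite measures carried by the unit circle are determined by their moments. -/
theorem measure_ext_of_moments [IsFiniteMeasure μ] [IsFiniteMeasure ν]
    (hμ : μ (Metric.sphere (0 : ℂ) 1)ᶜ = 0) (hν : ν (Metric.sphere (0 : ℂ) 1)ᶜ = 0)
    (h : ∀ j : ℕ, ∫ z, z ^ j ∂μ = ∫ z, z ^ j ∂ν) : μ = ν := by
  apply Measure.ext_of_charFun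
  ext t
  simp_rw [charFun_eq_tsum hμ, charFun_eq_tsum hν, integral_pow_mul_conj_pow_eq hμ hν h]

end Moments

section Arc

lemma arcMeasure_compl_sphere : arcMeasure (Metric.sphere (0 : ℂ) 1)ᶜ = 0 := by
  rw [arcMeasure, Measure.smul_apply, Measure.map_apply (continuous_circleMap 0 1).measurable
    Metric.isClosed_sphere.measurableSet.compl]
  have : circleMap 0 1 ⁻¹' (Metric.sphere (0 : ℂ) 1)ᶜ = ∅ := by
    ext θ; simp
  simp [this]

instance isFiniteMeasure_arcMeasure : IsFiniteMeasure arcMeasure := by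
  have h : (ENNReal.ofReal (2 * Real.pi))⁻¹ ≠ ⊤ := by simp [Real.pi_pos]
  have : IsFiniteMeasure ((volume.restrict (Set.Ioc (0 : ℝ) (2 * Real.pi))).map (circleMap 0 1)) :=
    inferInstance
  exact Measure.smul_finite _ h

lemma integral_arcMeasure {f : ℂ → ℂ} (hf : Continuous f) :
    ∫ z, f z ∂arcMeasure = Real.circleAverage f 0 1 := by
  rw [arcMeasure, integral_smul_measure, integral_map (continuous_circleMap 0 1).aemeasurable
    hf.aestronglyMeasurable, Real.circleAverage_def,
    intervalIntegral.integral_of_le Real.two_pi_pos.le, ENNReal.toReal_inv,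
    ENNReal.toReal_ofReal Real.two_pi_pos.le]

lemma integral_pow_arcMeasure (j : ℕ) :
    ∫ z, z ^ j ∂arcMeasure = if j = 0 then 1 else 0 := by
  rw [integral_arcMeasure (continuous_pow j), DiffContOnCl.circleAverage]
  · simp [zero_pow_eq]
  · exact (differentiable_pow j).diffContOnCl

end Arc

/-! ### Identification of the weight. -/

section Identification

variable {μ : Measure ℂ} {b A : ℝ}

namespace ExpDecay

lemma continuousOn_szegoLimit {α : ℕ → ℂ} (h : ExpDecay α b A) :
    ContinuousOn (szegoLimit α) (Metric.sphere 0 1) :=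
  h.differentiableOn_szegoLimit.continuousOn.mono fun z hz => by
    simpa using h.norm_lt_inv (le_of_eq (by simpa using hz))

lemma tendsto_integral_szegoRev [IsFiniteMeasure μ] (hμ : μ (Metric.sphere (0 : ℂ) 1)ᶜ = 0)
    {α : ℕ → ℂ} (h : ExpDecay α b A) (j : ℕ) :
    Tendsto (fun n => polyInner μ (X ^ j) (szegoRev α n)) atTop
      (𝓝 (∫ z, conj z ^ j * szegoLimit α z ∂μ)) := by
  refine tendsto_integral_of_dominated_convergence (fun _ => h.supBound) (fun n => ?_)
    (integrable_const _) (fun n => ?_) ?_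
  · exact (continuous_polyInner_integrand _ _).aestronglyMeasurable
  · filter_upwards [ae_norm_eq_one hμ] with z hz
    simpa [hz] using h.norm_szegoRev_le n hz.le
  · filter_upwards [ae_norm_eq_one hμ] with z hz
    simpa using (h.tendsto_szegoRev (h.norm_lt_inv hz.le)).const_mul (conj z ^ j)

variable (hμ : IsNontrivialCircleMeasure μ) (h : ExpDecay (verblunsky μ) b A)
include hμ h

lemma integral_conj_pow_mul_szegoLimit {j : ℕ} (hj : 1 ≤ j) :
    ∫ z, conj z ^ j * szegoLimit (verblunsky μ) z ∂μ = 0 := by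
  have := hμ.prob
  refine tendsto_nhds_unique (h.tendsto_integral_szegoRev hμ.carrier j) ?_
  refine tendsto_const_nhds.congr' ?_
  filter_upwards [eventually_ge_atTop j] with n hn
  exact (polyInner_X_pow_szegoRev hμ hj hn).symm

/-- The limit inherits orthogonality to z, z², …, so only the constant coefficient of R survives. -/
lemma integral_conj_eval_mul_szegoLimit (R : ℂ[X]) :
    ∫ z, conj (R.eval z) * szegoLimit (verblunsky μ) z ∂μ
      = conj (R.eval 0) * ∫ z, szegoLimit (verblunsky μ) z ∂μ := by
  have := hμ.prob
  have hint (R : ℂ[X]) : Integrable (fun z => conj (R.eval z) * szegoLimit (verblunsky μ) z) μ :=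
    integrable_of_continuousOn_sphere hμ.carrier
      ((Complex.continuous_conj.comp R.continuous).continuousOn.mul h.continuousOn_szegoLimit)
  induction R using Polynomial.induction_on' with
  | add p q hp hq =>
    simp only [eval_add, map_add, add_mul]
    rw [integral_add (hint p) (hint q), hp, hq]
  | monomial j c =>
    simp only [eval_monomial, map_mul, map_pow, mul_assoc]
    rw [integral_const_mul]
    rcases Nat.eq_zero_or_pos j with rfl | hj
    · simp
    · rw [h.integral_conj_pow_mul_szegoLimit hμ hj]
      simp [hj.ne']

/-- Take R = z^j Φₙ* in the previous identity and let n → ∞. Since Φₙ*(0) = 1, R(0) is 1 for j = 0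
and 0 otherwise. -/
lemma integral_conj_pow_mul_norm_sq (j : ℕ) :
    ∫ z, conj z ^ j * (‖szegoLimit (verblunsky μ) z‖ ^ 2 : ℝ) ∂μ
      = if j = 0 then ∫ z, szegoLimit (verblunsky μ) z ∂μ else 0 := by
  have := hμ.prob
  set α := verblunsky μ
  set N := ∫ z, szegoLimit α z ∂μ
  have hlim : Tendsto (fun n => ∫ z, conj ((X ^ j * szegoRev α n).eval z) * szegoLimit α z ∂μ) atTop
      (𝓝 (∫ z, conj z ^ j * (‖szegoLimit α z‖ ^ 2 : ℝ) ∂μ)) := by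
    refine tendsto_integral_of_dominated_convergence (fun _ => h.supBound * h.supBound)
      (fun n => ?_) (integrable_const _) (fun n => ?_) ?_
    · exact (integrable_of_continuousOn_sphere hμ.carrier
        ((Complex.continuous_conj.comp (Polynomial.continuous _)).continuousOn.mul
          h.continuousOn_szegoLimit)).aestronglyMeasurable
    · filter_upwards [ae_norm_eq_one hμ.carrier] with z hz
      rw [norm_mul, RCLike.norm_conj]
      have h1 : ‖(X ^ j * szegoRev α n).eval z‖ ≤ h.supBound := by
        simpa [hz] using h.norm_szegoRev_le n hz.le
      exact mul_le_mul h1 (h.norm_szegoLimit_le hz.le) (norm_nonneg _) h.supBound_nonneg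
    · filter_upwards [ae_norm_eq_one hμ.carrier] with z hz
      have h1 := (Complex.continuous_conj.tendsto _).comp (h.tendsto_szegoRev (h.norm_lt_inv hz.le))
      have h2 := (h1.const_mul (conj z ^ j)).mul_const (szegoLimit α z)
      have h3 : conj z ^ j * conj (szegoLimit α z) * szegoLimit α z
          = conj z ^ j * (‖szegoLimit α z‖ ^ 2 : ℝ) := by
        rw [mul_assoc, mul_comm (conj (szegoLimit α z)), Complex.mul_conj']; push_cast; rfl
      rw [h3] at h2
      refine h2.congr fun n => ?_
      simp
  refine tendsto_nhds_unique hlim ?_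
  refine tendsto_const_nhds.congr fun n => ?_
  rw [h.integral_conj_eval_mul_szegoLimit hμ]
  rcases Nat.eq_zero_or_pos j with rfl | hj
  · simp [N, α]
  · simp [hj.ne']

/-- The limit of `‖Φₙ‖²`, written as an integral of the limit function, is positive. -/
lemma integral_norm_sq_szegoLimit_pos :
    0 < ∫ z, ‖szegoLimit (verblunsky μ) z‖ ^ 2 ∂μ := by
  have := hμ.prob
  have hint : Integrable (fun z => ‖szegoLimit (verblunsky μ) z‖ ^ 2) μ :=
    integrable_of_continuousOn_sphere hμ.carrier (h.continuousOn_szegoLimit.norm.pow 2)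
  rw [integral_pos_iff_support_of_nonneg (fun z => by positivity) hint]
  have h1 : ∀ᵐ z ∂μ, z ∈ Function.support fun z => ‖szegoLimit (verblunsky μ) z‖ ^ 2 := by
    filter_upwards [ae_norm_eq_one hμ.carrier] with z hz
    simpa using h.szegoLimit_ne_zero (norm_verblunsky_lt_one hμ) hz.le
  have h2 := prob_compl_eq_zero_iff₀ (μ := μ) (s := Function.support fun z =>
    ‖szegoLimit (verblunsky μ) z‖ ^ 2) (by
      refine NullMeasurableSet.congr (s := Set.univ) MeasurableSet.univ.nullMeasurableSet ?_
      exact (eventuallyEq_univ.2 h1).symm)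
  rw [h2.1 h1]
  exact one_pos

/-- Both measures have vanishing moments of positive order and the same total mass. -/
lemma withDensity_norm_sq :
    μ.withDensity (fun z => ENNReal.ofReal (‖szegoLimit (verblunsky μ) z‖ ^ 2))
      = ENNReal.ofReal (∫ z, ‖szegoLimit (verblunsky μ) z‖ ^ 2 ∂μ) • arcMeasure := by
  have := hμ.prob
  set F := szegoLimit (verblunsky μ)
  set N := ∫ z, ‖F z‖ ^ 2 ∂μ with hN
  have hN0 : 0 < N := h.integral_norm_sq_szegoLimit_pos hμ
  have hint : Integrable (fun z => ‖F z‖ ^ 2) μ :=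
    integrable_of_continuousOn_sphere hμ.carrier (h.continuousOn_szegoLimit.norm.pow 2)
  have hfin1 : IsFiniteMeasure (μ.withDensity (fun z => ENNReal.ofReal (‖F z‖ ^ 2))) :=
    isFiniteMeasure_withDensity_ofReal hint.2
  have hfin2 : IsFiniteMeasure (ENNReal.ofReal N • arcMeasure) :=
    Measure.smul_finite _ ENNReal.ofReal_ne_top
  refine measure_ext_of_moments (withDensity_absolutelyContinuous _ _ hμ.carrier) ?_ fun j => ?_
  · rw [Measure.smul_apply, arcMeasure_compl_sphere]; simp
  · rw [integral_smul_measure, integral_pow_arcMeasure, ENNReal.toReal_ofReal hN0.le,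
      integral_withDensity_eq_integral_toReal_smul₀ hint.aemeasurable.ennreal_ofReal
        (by simp)]
    have h0 := h.integral_conj_pow_mul_norm_sq hμ 0
    have hj := congrArg conj (h.integral_conj_pow_mul_norm_sq hμ j)
    simp only [pow_zero, one_mul, if_true] at h0
    rw [integral_complex_ofReal] at h0
    rw [← integral_conj, ← h0, apply_ite conj, Complex.conj_ofReal, map_zero] at hj
    have e : ∫ z, (ENNReal.ofReal (‖F z‖ ^ 2)).toReal • z ^ j ∂μ
        = ∫ z, conj (conj z ^ j * ((‖F z‖ ^ 2 : ℝ) : ℂ)) ∂μ := by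
      congr 1
      ext z
      rw [ENNReal.toReal_ofReal (by positivity), map_mul, map_pow, Complex.conj_conj,
        Complex.conj_ofReal, mul_comm, Complex.real_smul, mul_comm]
    rw [e, hj]
    split_ifs <;> simp [N, F]

/-- The weight of a measure with exponentially decaying Verblunsky coefficients. -/
theorem weight_ae_eq : ∀ᵐ z ∂arcMeasure, weight μ z
    = (∫ z, ‖szegoLimit (verblunsky μ) z‖ ^ 2 ∂μ) / ‖szegoLimit (verblunsky μ) z‖ ^ 2 := by
  have := hμ.prob
  set F := szegoLimit (verblunsky μ)
  set N := ∫ z, ‖F z‖ ^ 2 ∂μ with hN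
  have hN0 : 0 < N := h.integral_norm_sq_szegoLimit_pos hμ
  have hF0 (z : ℂ) (hz : ‖z‖ = 1) : F z ≠ 0 :=
    h.szegoLimit_ne_zero (norm_verblunsky_lt_one hμ) hz.le
  have hmeas {ρ : Measure ℂ} [IsFiniteMeasure ρ] (hρ : ρ (Metric.sphere (0 : ℂ) 1)ᶜ = 0) :
      AEMeasurable (fun z => ENNReal.ofReal (‖F z‖ ^ 2)) ρ :=
    (integrable_of_continuousOn_sphere hρ
      (h.continuousOn_szegoLimit.norm.pow 2)).aemeasurable.ennreal_ofReal
  -- As F has no zeros on the circle, the density |F|² can be inverted; in particular μ has no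
  -- singular part.
  have hμeq : μ = arcMeasure.withDensity
      (ENNReal.ofReal N • fun z => (ENNReal.ofReal (‖F z‖ ^ 2))⁻¹) := by
    have h1 := withDensity_inv_same₀ (hmeas hμ.carrier)
      (by filter_upwards [ae_norm_eq_one hμ.carrier] with z hz
          have := norm_pos_iff.2 (hF0 z hz)
          simpa using hF0 z hz) (by simp)
    rw [h.withDensity_norm_sq hμ, withDensity_smul_measure] at h1
    rw [withDensity_smul' _ _ ENNReal.ofReal_ne_top]
    exact h1.symm
  have hrn := Measure.rnDeriv_withDensity₀ arcMeasure
    (f := ENNReal.ofReal N • fun z => (ENNReal.ofReal (‖F z‖ ^ 2))⁻¹)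
    ((hmeas arcMeasure_compl_sphere).inv.const_smul _)
  rw [← hμeq] at hrn
  filter_upwards [hrn, ae_norm_eq_one arcMeasure_compl_sphere] with z hz hz1
  rw [weight, hz, Pi.smul_apply, smul_eq_mul, ENNReal.toReal_mul, ENNReal.toReal_inv,
    ENNReal.toReal_ofReal hN0.le, ENNReal.toReal_ofReal (by positivity), div_eq_mul_inv]

end ExpDecay

end Identification

end OPUC

/-! ### The Schwarz integral and the Szegő function. -/

namespace OPUC

section Herglotz

variable {f : ℂ → ℂ} {R : ℝ} {z : ℂ}

lemma sub_ne_zero_of_mem_sphere (hz : ‖z‖ < 1) {w : ℂ} (hw : w ∈ Metric.sphere (0 : ℂ) 1) :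
    w - z ≠ 0 := by
  intro h
  rw [← sub_eq_zero.1 h] at hz
  simp at hw
  linarith

lemma continuousOn_kernel (hz : ‖z‖ < 1) :
    ContinuousOn (fun w : ℂ => (w + z) / (w - z)) (Metric.sphere 0 1) :=
  ContinuousOn.div (by fun_prop) (by fun_prop) fun _ hw => sub_ne_zero_of_mem_sphere hz hw

/-- The kernel equals 2w/(w - z) - 1, so this is Cauchy's formula combined with the mean value
property. -/
lemma circleAverage_kernel_mul (hR : 1 < R) (hf : DifferentiableOn ℂ f (Metric.ball 0 R))
    (hz : ‖z‖ < 1) :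
    Real.circleAverage (fun w => (w + z) / (w - z) * f w) 0 1 = 2 * f z - f 0 := by
  have hd : DiffContOnCl ℂ f (Metric.ball 0 |1|) := by
    rw [abs_one]
    exact hf.diffContOnCl_ball (Metric.closedBall_subset_ball hR)
  have hfc : ContinuousOn f (Metric.sphere 0 1) :=
    hf.continuousOn.mono (Metric.sphere_subset_closedBall.trans (Metric.closedBall_subset_ball hR))
  have h1 := hd.circleAverage_smul_div (w := z) (by simpa using hz)
  have h2 := hd.circleAverage
  have hint1 : CircleIntegrable (fun w : ℂ => ((w - 0) / (w - z)) • f w) 0 1 := by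
    apply ContinuousOn.circleIntegrable zero_le_one
    exact (ContinuousOn.div (by fun_prop) (by fun_prop)
      fun _ hw => sub_ne_zero_of_mem_sphere hz hw).smul hfc
  have hint2 : CircleIntegrable f 0 1 := hfc.circleIntegrable zero_le_one
  have h3 : Real.circleAverage (fun w => (w + z) / (w - z) * f w) 0 1
      = Real.circleAverage ((2 : ℂ) • (fun w : ℂ => ((w - 0) / (w - z)) • f w) - f) 0 1 := by
    apply Real.circleAverage_congr_sphere
    intro w hw
    have := sub_ne_zero_of_mem_sphere hz (by simpa using hw)
    simp only [Pi.sub_apply, Pi.smul_apply, smul_eq_mul, sub_zero]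
    field_simp
    ring
  rw [h3, Real.circleAverage_sub (hint1.const_smul) hint2, Real.circleAverage_smul, h1, h2,
    smul_eq_mul]

lemma circleAverage_conj (g : ℂ → ℂ) :
    Real.circleAverage (fun w => conj (g w)) 0 1 = conj (Real.circleAverage g 0 1) := by
  rw [Real.circleAverage_def, Real.circleAverage_def, intervalIntegral.intervalIntegral_conj, Complex.real_smul,
    Complex.real_smul, map_mul, Complex.conj_ofReal]

/-- On the circle the kernel is the conjugate of (1 + z̄w)/(1 - z̄w), which is holomorphic on the
closed disk and equals 1 at the origin, so the mean value property applies to its product with f. -/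
lemma circleAverage_kernel_mul_conj (hR : 1 < R) (hf : DifferentiableOn ℂ f (Metric.ball 0 R))
    (hz : ‖z‖ < 1) :
    Real.circleAverage (fun w => (w + z) / (w - z) * conj (f w)) 0 1 = conj (f 0) := by
  have hne (w : ℂ) (hw : ‖w‖ ≤ 1) : 1 - conj z * w ≠ 0 := by
    intro h
    have h1 : ‖conj z * w‖ = 1 := by rw [← sub_eq_zero.1 h, norm_one]
    rw [norm_mul, RCLike.norm_conj] at h1
    nlinarith [norm_nonneg z, norm_nonneg w]
  have hd : DiffContOnCl ℂ (fun w => (1 + conj z * w) / (1 - conj z * w) * f w)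
      (Metric.ball 0 |1|) := by
    rw [abs_one]
    apply DifferentiableOn.diffContOnCl
    rw [closure_ball _ one_ne_zero]
    refine DifferentiableOn.mul (DifferentiableOn.div (by fun_prop) (by fun_prop) fun w hw => ?_)
      (hf.mono (Metric.closedBall_subset_ball hR))
    exact hne w (by simpa using hw)
  have h1 := hd.circleAverage
  simp only [mul_zero, add_zero, sub_zero, div_one, one_mul] at h1
  rw [← h1, ← circleAverage_conj]
  apply Real.circleAverage_congr_sphere
  intro w hw
  rw [abs_one] at hw
  have hw1 : ‖w‖ = 1 := by simpa using hw
  have hwz := sub_ne_zero_of_mem_sphere hz hw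
  have hww : w * conj w = 1 := by rw [Complex.mul_conj', hw1]; simp
  have hne' : 1 - z * conj w ≠ 0 := by
    have := (map_ne_zero (starRingEnd ℂ)).2 (hne w hw1.le)
    simpa using this
  simp only [map_mul, map_div₀, map_add, map_sub, map_one, Complex.conj_conj]
  congr 1
  rw [div_eq_div_iff hwz hne']
  linear_combination (-2 * z) * hww

end Herglotz

/-- A zero-free holomorphic function on a disk is an exponential. -/
lemma exists_log_of_ne_zero {F : ℂ → ℂ} {R : ℝ} (hR : 0 < R)
    (hF : DifferentiableOn ℂ F (Metric.ball 0 R)) (hF0 : ∀ z ∈ Metric.ball (0 : ℂ) R, F z ≠ 0)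
    (h1 : F 0 = 1) :
    ∃ L : ℂ → ℂ, DifferentiableOn ℂ L (Metric.ball 0 R) ∧ L 0 = 0 ∧
      ∀ z ∈ Metric.ball (0 : ℂ) R, Complex.exp (L z) = F z := by
  have hd : DifferentiableOn ℂ (fun z => deriv F z / F z) (Metric.ball 0 R) :=
    (hF.deriv Metric.isOpen_ball).div hF hF0
  obtain ⟨L, hL0, hL⟩ := hd.isExactOn_ball.with_val_at 0 0
  refine ⟨L, fun z hz => (hL z hz).differentiableAt.differentiableWithinAt, hL0, ?_⟩
  have hder (z : ℂ) (hz : z ∈ Metric.ball (0 : ℂ) R) :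
      HasDerivAt (fun z => Complex.exp (-L z) * F z) 0 z := by
    have hFz := (hF.differentiableAt (Metric.isOpen_ball.mem_nhds hz)).hasDerivAt
    convert! (hL z hz).neg.cexp.mul hFz using 1
    have := hF0 z hz
    field_simp
    simp
  have hconst : ∀ z ∈ Metric.ball (0 : ℂ) R, Complex.exp (-L z) * F z = 1 := by
    intro z hz
    have h := Metric.isOpen_ball.is_const_of_deriv_eq_zero (convex_ball (0 : ℂ) R).isPreconnected
      (fun w hw => (hder w hw).differentiableAt.differentiableWithinAt)
      (fun w hw => (hder w hw).deriv) hz (Metric.mem_ball_self hR)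
    simpa [hL0, h1] using h
  intro z hz
  have := hconst z hz
  rw [Complex.exp_neg] at this
  exact (inv_mul_eq_one₀ (Complex.exp_ne_zero _)).1 this

section

variable {μ : Measure ℂ} {b A : ℝ}

lemma ae_circleMap_of_ae_arcMeasure {p : ℂ → Prop} (h : ∀ᵐ z ∂arcMeasure, p z) :
    ∀ᵐ θ : ℝ, θ ∈ Set.uIoc (0 : ℝ) (2 * Real.pi) → p (circleMap 0 1 θ) := by
  have h0 : (ENNReal.ofReal (2 * Real.pi))⁻¹ ≠ 0 := ENNReal.inv_ne_zero.2 ENNReal.ofReal_ne_top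
  rw [arcMeasure, Measure.ae_ennreal_smul_measure_eq h0] at h
  have h1 := ae_of_ae_map (continuous_circleMap 0 1).aemeasurable h
  rw [ae_restrict_iff' measurableSet_Ioc] at h1
  rwa [Set.uIoc_of_le Real.two_pi_pos.le]

/-- The Szegő function is the reciprocal of the normalized limit of the reversed polynomials. -/
theorem ExpDecay.szegoD_eq (hμ : IsNontrivialCircleMeasure μ) (h : ExpDecay (verblunsky μ) b A)
    {z : ℂ} (hz : ‖z‖ < 1) :
    szegoD μ z = (Real.sqrt (∫ z, ‖szegoLimit (verblunsky μ) z‖ ^ 2 ∂μ) : ℂ)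
      / szegoLimit (verblunsky μ) z := by
  have hN := h.integral_norm_sq_szegoLimit_pos hμ
  have hw := h.weight_ae_eq hμ
  set F := szegoLimit (verblunsky μ) with hFdef
  set N := ∫ z, ‖F z‖ ^ 2 ∂μ
  -- By compactness F is zero-free on a disk of radius greater than 1, so its logarithm is
  -- holomorphic across the unit circle.
  have hU : IsOpen (Metric.ball (0 : ℂ) b⁻¹ ∩ {z | F z ≠ 0}) :=
    h.differentiableOn_szegoLimit.continuousOn.isOpen_inter_preimage Metric.isOpen_ball
      isOpen_compl_singleton
  obtain ⟨ε, hε, hsub⟩ := (isCompact_closedBall (0 : ℂ) 1).exists_thickening_subset_open hU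
    fun w hw => by
      have hw1 : ‖w‖ ≤ 1 := by simpa using hw
      exact ⟨by simpa using h.norm_lt_inv hw1,
        h.szegoLimit_ne_zero (norm_verblunsky_lt_one hμ) hw1⟩
  rw [thickening_closedBall hε zero_le_one] at hsub
  set R := ε + 1
  have hR : 1 < R := by simp only [R]; linarith
  obtain ⟨L, hLd, hL0, hL⟩ := exists_log_of_ne_zero (F := F) (R := R) (by linarith)
    (h.differentiableOn_szegoLimit.mono fun w hw => (hsub hw).1) (fun w hw => (hsub hw).2)
    (szegoLimit_zero _)
  -- A logarithm of √N/F. On the circle log w = f + conj f almost everywhere, and since f(0) is real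
  -- the two kernel averages add up to 2f(z).
  set f : ℂ → ℂ := fun w => ((Real.log N / 2 : ℝ) : ℂ) - L w with hf
  have hfd : DifferentiableOn ℂ f (Metric.ball 0 R) := (differentiableOn_const _).sub hLd
  have hsphere : Metric.sphere (0 : ℂ) 1 ⊆ Metric.ball 0 R :=
    Metric.sphere_subset_closedBall.trans (Metric.closedBall_subset_ball hR)
  have hlog {w : ℂ} (hw : w ∈ Metric.sphere (0 : ℂ) 1) :
      ((Real.log (N / ‖F w‖ ^ 2) : ℝ) : ℂ) = f w + conj (f w) := by
    have hFw : ‖F w‖ = Real.exp (L w).re := by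
      rw [← hL w (hsphere hw), Complex.norm_exp]
    rw [Complex.add_conj, hFw, Real.log_div hN.ne' (by positivity), Real.log_pow, Real.log_exp]
    simp only [hf, Complex.sub_re, Complex.ofReal_re]
    push_cast
    ring
  have hfc : ContinuousOn f (Metric.sphere 0 1) := hfd.continuousOn.mono hsphere
  have hint1 : CircleIntegrable (fun w => (w + z) / (w - z) * f w) 0 1 :=
    ((continuousOn_kernel hz).mul hfc).circleIntegrable zero_le_one
  have hint2 : CircleIntegrable (fun w => (w + z) / (w - z) * conj (f w)) 0 1 :=
    ((continuousOn_kernel hz).mul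
      (Complex.continuous_conj.comp_continuousOn hfc)).circleIntegrable zero_le_one
  have havg : (∫ θ in (0 : ℝ)..(2 * Real.pi), (circleMap 0 1 θ + z) / (circleMap 0 1 θ - z)
        * (Real.log (weight μ (circleMap 0 1 θ)) : ℂ))
      = 2 * Real.pi * (2 * f z) := by
    have e1 : (∫ θ in (0 : ℝ)..(2 * Real.pi), (circleMap 0 1 θ + z) / (circleMap 0 1 θ - z)
          * (Real.log (weight μ (circleMap 0 1 θ)) : ℂ))
        = 2 * Real.pi * Real.circleAverage (fun w => (w + z) / (w - z) * f w
            + (w + z) / (w - z) * conj (f w)) 0 1 := by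
      rw [Real.circleAverage_def, Complex.real_smul, ← mul_assoc]
      have : (2 : ℂ) * Real.pi * ((2 * Real.pi : ℝ)⁻¹ : ℝ) = 1 := by
        push_cast
        have : (Real.pi : ℂ) ≠ 0 := by exact_mod_cast Real.pi_ne_zero
        field_simp
      rw [this, one_mul]
      apply intervalIntegral.integral_congr_ae
      filter_upwards [ae_circleMap_of_ae_arcMeasure hw] with θ hθ hθm
      rw [hθ hθm, hlog (by simp)]
      ring
    rw [e1, Real.circleAverage_fun_add hint1 hint2, circleAverage_kernel_mul hR hfd hz,
      circleAverage_kernel_mul_conj hR hfd hz]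
    congr 1
    simp only [hf, hL0, sub_zero, Complex.conj_ofReal]
    ring
  have hzR : z ∈ Metric.ball (0 : ℂ) R := by simpa using hz.trans hR
  rw [szegoD, havg]
  have e2 : (1 / (4 * Real.pi) : ℂ) * (2 * Real.pi * (2 * f z)) = f z := by
    have : (Real.pi : ℂ) ≠ 0 := by exact_mod_cast Real.pi_ne_zero
    field_simp
    ring
  rw [e2, hf]
  simp only
  rw [Complex.exp_sub, hL z hzR, ← Complex.ofReal_exp, Real.exp_half, Real.exp_log hN]

end

end OPUC

/-! ### Zeros of the local equation. -/

namespace OPUC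

lemma norm_one_add_pow_sub_one_le {x : ℂ} (n : ℕ) (hx : n * ‖x‖ ≤ 1 / 2) :
    ‖(1 + x) ^ n - 1‖ ≤ 2 * (n * ‖x‖) := by
  induction n with
  | zero => simp
  | succ n ih =>
    push_cast at hx ⊢
    have h0 := norm_nonneg x
    have h1 := ih (by linarith)
    have h2 : (1 + x) ^ (n + 1) - 1 = ((1 + x) ^ n - 1) * (1 + x) + x := by ring
    have h3 : ‖1 + x‖ ≤ 1 + ‖x‖ := (norm_add_le _ _).trans (by rw [norm_one])
    rw [h2]
    refine (norm_add_le _ _).trans ?_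
    rw [norm_mul]
    have h4 : ‖(1 + x) ^ n - 1‖ * ‖1 + x‖ ≤ 2 * (n * ‖x‖) * (1 + ‖x‖) := by gcongr
    have h5 : (n : ℝ) * ‖x‖ ≤ 1 / 2 := by linarith
    nlinarith

/-- The data of an equation `(z - z₀)ᵏ = (b / z)ⁿ q(z) + eₙ(z)` near `z₀`, with an exponentially
smaller error `eₙ`. -/
structure LocalEquation (z₀ : ℂ) (b Δ δ K : ℝ) (q : ℂ → ℂ) (e : ℕ → ℂ → ℂ) : Prop where
  b_pos : 0 < b
  Δ_pos : 0 < Δ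
  Δ_lt_one : Δ < 1
  δ_pos : 0 < δ
  lt_norm : ∀ z ∈ Metric.ball z₀ δ, b < ‖z‖
  lead_diff : DifferentiableOn ℂ q (Metric.ball z₀ δ)
  lead_ne_zero : q z₀ ≠ 0
  lead_bound : ∀ z ∈ Metric.ball z₀ δ, ‖q z‖ ≤ K
  lead_lip : ∀ z ∈ Metric.ball z₀ δ, ‖q z - q z₀‖ ≤ K * ‖z - z₀‖
  error_diff : ∀ n, DifferentiableOn ℂ (e n) (Metric.ball z₀ δ)
  error_bound : ∀ n, ∀ z ∈ Metric.ball z₀ δ, ‖e n z‖ ≤ K * (b * Δ / ‖z‖) ^ n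

namespace LocalEquation

variable {z₀ : ℂ} {b Δ δ K : ℝ} {q : ℂ → ℂ} {e : ℕ → ℂ → ℂ}

lemma center_mem (h : LocalEquation z₀ b Δ δ K q e) : z₀ ∈ Metric.ball z₀ δ :=
  Metric.mem_ball_self h.δ_pos

lemma norm_pos (h : LocalEquation z₀ b Δ δ K q e) {z : ℂ} (hz : z ∈ Metric.ball z₀ δ) : 0 < ‖z‖ :=
  h.b_pos.trans (h.lt_norm z hz)

lemma const_nonneg (h : LocalEquation z₀ b Δ δ K q e) : 0 ≤ K :=
  (norm_nonneg _).trans (h.lead_bound z₀ h.center_mem)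

/-- Near `z₀` the right-hand side of the equation is close to `(b / z₀)ⁿ q(z₀)`. -/
lemma exists_rhs_estimate (h : LocalEquation z₀ b Δ δ K q e) : ∃ κ > 0, ∃ M > 0, ∀ n : ℕ,
    ∀ z ∈ Metric.ball z₀ δ, (n + 1) * ‖z - z₀‖ ≤ κ →
      ‖((b / z) ^ n * q z + e n z) / (q z₀ * (b / z₀) ^ n) - 1‖
        ≤ M * ((n + 1) * ‖z - z₀‖ + Δ ^ n) := by
  have hK := h.const_nonneg
  have hz₀ := h.norm_pos h.center_mem
  have hb := h.b_pos
  have hΔ := h.Δ_pos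
  have ha : 0 < ‖q z₀‖ := norm_pos_iff.2 h.lead_ne_zero
  -- The bound |z₀|/4 ensures |z| ≥ |z₀|/2 and n|z₀/z - 1| ≤ 1/2, as the power estimate requires.
  refine ⟨‖z₀‖ / 4, by positivity, 4 / ‖z₀‖ + 2 * K / ‖q z₀‖ + 2 * K / ‖q z₀‖, by positivity, ?_⟩
  intro n z hz hκ
  have hzp := h.norm_pos hz
  have hz0 : z ≠ 0 := norm_pos_iff.1 hzp
  have hz₀0 : z₀ ≠ 0 := norm_pos_iff.1 hz₀
  set t := ‖z - z₀‖ with ht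
  have ht0 : 0 ≤ t := norm_nonneg _
  have hn0 : (0 : ℝ) ≤ n := n.cast_nonneg
  have ht1 : t ≤ ‖z₀‖ / 4 := by nlinarith
  have hzlow : ‖z₀‖ / 2 ≤ ‖z‖ := by
    have := norm_sub_norm_le z₀ (z₀ - z)
    rw [sub_sub_cancel, norm_sub_rev z₀ z, ← ht] at this
    linarith
  set x := (z₀ - z) / z with hx
  have hxn : ‖x‖ ≤ 2 * t / ‖z₀‖ := by
    rw [hx, norm_div, norm_sub_rev, ← ht, div_le_div_iff₀ hzp hz₀]
    nlinarith
  have hnx' : n * ‖x‖ ≤ 2 * (n * t) / ‖z₀‖ := by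
    calc n * ‖x‖ ≤ n * (2 * t / ‖z₀‖) := by gcongr
      _ = _ := by ring
  have hnx : n * ‖x‖ ≤ 1 / 2 := by
    refine hnx'.trans ?_
    rw [div_le_iff₀ hz₀]
    nlinarith
  have hA := norm_one_add_pow_sub_one_le n hnx
  have hx1 : 1 + x = z₀ / z := by rw [hx]; field_simp; ring
  rw [hx1] at hA
  set Aₙ := (z₀ / z) ^ n - 1 with hAₙ
  have hA1 : ‖Aₙ‖ ≤ 1 := hA.trans (by linarith)
  set B := (q z - q z₀) / q z₀ with hB
  have hBn : ‖B‖ ≤ K * t / ‖q z₀‖ := by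
    rw [hB, norm_div]
    gcongr
    exact h.lead_lip z hz
  set E := e n z / (q z₀ * (b / z₀) ^ n) with hE
  have hEn : ‖E‖ ≤ 2 * K / ‖q z₀‖ * Δ ^ n := by
    have h1 : ‖z₀ / z‖ ^ n ≤ 2 := by
      rw [← norm_pow, show (z₀ / z) ^ n = Aₙ + 1 by rw [hAₙ]; ring]
      refine (norm_add_le _ _).trans ?_
      rw [norm_one]; linarith
    rw [hE, norm_div, norm_mul, norm_pow, norm_div, Complex.norm_real, Real.norm_of_nonneg hb.le]
    calc ‖e n z‖ / (‖q z₀‖ * (b / ‖z₀‖) ^ n)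
        ≤ K * (b * Δ / ‖z‖) ^ n / (‖q z₀‖ * (b / ‖z₀‖) ^ n) := by
          gcongr; exact h.error_bound n z hz
      _ = K / ‖q z₀‖ * Δ ^ n * ‖z₀ / z‖ ^ n := by
          rw [norm_div, div_pow, div_pow, div_pow, mul_pow]
          field_simp
      _ ≤ K / ‖q z₀‖ * Δ ^ n * 2 := by gcongr
      _ = _ := by ring
  have hb0 : (b : ℂ) ≠ 0 := by exact_mod_cast hb.ne'
  have hq0 := h.lead_ne_zero
  -- The quotient is (1 + A)(1 + B) + E: A comes from moving z to z₀ in the n-th power, B from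
  -- moving it in q, and E from eₙ.
  have hsplit : ((b / z) ^ n * q z + e n z) / (q z₀ * (b / z₀) ^ n) - 1
      = Aₙ + B + Aₙ * B + E := by
    have h1 : (b / z : ℂ) ^ n * q z / (q z₀ * (b / z₀) ^ n) = (1 + Aₙ) * (1 + B) := by
      have e1 : (1 + Aₙ) = (z₀ / z) ^ n := by rw [hAₙ]; ring
      have e2 : 1 + B = q z / q z₀ := by rw [hB]; field_simp; ring
      rw [e1, e2, div_pow, div_pow, div_pow]
      field_simp
    rw [add_div, h1]; ring
  rw [hsplit]
  have hAB : ‖Aₙ * B‖ ≤ ‖B‖ := by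
    rw [norm_mul]; exact mul_le_of_le_one_left (norm_nonneg _) hA1
  have htri : ‖Aₙ + B + Aₙ * B + E‖ ≤ ‖Aₙ‖ + ‖B‖ + ‖Aₙ * B‖ + ‖E‖ :=
    (norm_add_le _ _).trans (by gcongr; exact (norm_add_le _ _).trans (by gcongr; exact norm_add_le _ _))
  have hΔn : 0 ≤ Δ ^ n := by positivity
  have hnt : 0 ≤ n * t := by positivity
  have hc1 : 0 ≤ 4 / ‖z₀‖ := by positivity
  have hc2 : 0 ≤ K / ‖q z₀‖ := by positivity
  have f1 : ‖Aₙ‖ ≤ 4 / ‖z₀‖ * (n * t) := by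
    refine hA.trans ?_
    calc 2 * (n * ‖x‖) ≤ 2 * (2 * (n * t) / ‖z₀‖) := by gcongr
      _ = _ := by ring
  have f2 : ‖B‖ ≤ K / ‖q z₀‖ * t := hBn.trans_eq (by ring)
  have f3 : 2 * K / ‖q z₀‖ = 2 * (K / ‖q z₀‖) := by ring
  rw [f3] at hEn ⊢
  have g1 : 0 ≤ 4 / ‖z₀‖ * t := by positivity
  have g2 : 0 ≤ 4 / ‖z₀‖ * Δ ^ n := by positivity
  have g3 : 0 ≤ K / ‖q z₀‖ * (n * t) := by positivity
  have g4 : 0 ≤ K / ‖q z₀‖ * t := by positivity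
  have g5 : 0 ≤ K / ‖q z₀‖ * Δ ^ n := by positivity
  nlinarith

/-- Exclusion of zeros away from the scale of the leading term. -/
lemma exists_ball_zeros_small (h : LocalEquation z₀ b Δ δ K q e) {k : ℕ} (hk : 1 ≤ k)
    {c : ℕ → ℂ} (hc : ∀ n, c n ^ k = q z₀ * (b / z₀) ^ n) :
    ∃ δ' > 0, δ' ≤ δ ∧ ∀ᶠ n : ℕ in atTop, ∀ z ∈ Metric.ball z₀ δ',
      (z - z₀) ^ k = (b / z) ^ n * q z + e n z → ‖z - z₀‖ < 2 * ‖c n‖ := by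
  have hK := h.const_nonneg
  have hz₀ := h.norm_pos h.center_mem
  have hb := h.b_pos
  have hbz := h.lt_norm z₀ h.center_mem
  have hk0 : k ≠ 0 := by omega
  obtain ⟨κ, hκ, M, hM, hest⟩ := h.exists_rhs_estimate
  -- Keeping |z| above some r > b makes b/|z| uniformly smaller than 1 on the smaller ball.
  set r := (b + ‖z₀‖) / 2 with hr
  have hbr : b < r := by rw [hr]; linarith
  have hrz : r < ‖z₀‖ := by rw [hr]; linarith
  have hr0 : 0 < r := hb.trans hbr
  refine ⟨min δ (‖z₀‖ - r), lt_min h.δ_pos (by linarith), min_le_left _ _, ?_⟩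
  set β := b / r
  have hβ0 : 0 < β := by positivity
  have hβ1 : β < 1 := (div_lt_one hr0).2 hbr
  set κ' := min κ (1 / (4 * M))
  have hκ' : 0 < κ' := lt_min hκ (by positivity)
  have hlim : Tendsto (fun n : ℕ => 2 * K * ((n + 1 : ℝ) ^ k * β ^ n)) atTop (𝓝 0) := by
    have h1 := (tendsto_pow_const_mul_const_pow_of_lt_one k hβ0.le hβ1).comp (tendsto_add_atTop_nat 1)
    have h2 := h1.const_mul (2 * K / β)
    rw [mul_zero] at h2
    refine h2.congr fun n => ?_
    simp only [Function.comp, pow_succ β]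
    push_cast
    field_simp
  have hΔlim : Tendsto (fun n : ℕ => M * Δ ^ n) atTop (𝓝 0) := by
    simpa using (tendsto_pow_atTop_nhds_zero_of_lt_one h.Δ_pos.le h.Δ_lt_one).const_mul M
  filter_upwards [hlim.eventually_lt_const (pow_pos hκ' k),
    hΔlim.eventually_lt_const (show (0 : ℝ) < 1 / 4 by norm_num)] with n hn1 hn2 z hz heq
  have hzδ : z ∈ Metric.ball z₀ δ := Metric.ball_subset_ball (min_le_left _ _) hz
  have hzr : r < ‖z‖ := by
    have h1 : ‖z - z₀‖ < ‖z₀‖ - r := by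
      have := Metric.mem_ball.1 hz
      rw [dist_eq_norm] at this
      exact this.trans_le (min_le_right _ _)
    have := norm_sub_norm_le z₀ (z₀ - z)
    rw [sub_sub_cancel, norm_sub_rev z₀ z] at this
    linarith
  have hzp := hr0.trans hzr
  set t := ‖z - z₀‖ with ht
  have ht0 : 0 ≤ t := norm_nonneg _
  -- A crude first bound: any solution is exponentially close to z₀. This makes (n + 1)|z - z₀|
  -- small enough for the relative estimate, which then gives the sharp scale.
  have htk : t ^ k ≤ 2 * K * β ^ n := by
    have hβz : b / ‖z‖ ≤ β := div_le_div_of_nonneg_left hb.le hr0 hzr.le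
    rw [ht, ← norm_pow, heq]
    refine (norm_add_le _ _).trans ?_
    rw [norm_mul, norm_pow, norm_div, Complex.norm_real, Real.norm_of_nonneg hb.le]
    have h1 : (b / ‖z‖) ^ n * ‖q z‖ ≤ β ^ n * K := by
      gcongr; exact h.lead_bound z hzδ
    have h2 : ‖e n z‖ ≤ K * β ^ n := by
      refine (h.error_bound n z hzδ).trans ?_
      have : b * Δ / ‖z‖ ≤ β := by
        refine le_trans ?_ hβz
        gcongr
        nlinarith [h.Δ_lt_one]
      have := h.Δ_pos
      gcongr
    linarith
  have hsmall : (n + 1) * t ≤ κ' := by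
    have h1 : ((n + 1) * t) ^ k < κ' ^ k := by
      refine lt_of_le_of_lt ?_ hn1
      rw [mul_pow]
      calc ((n : ℝ) + 1) ^ k * t ^ k ≤ ((n : ℝ) + 1) ^ k * (2 * K * β ^ n) := by gcongr
        _ = _ := by ring
    exact (lt_of_pow_lt_pow_left₀ k hκ'.le h1).le
  have hτ := hest n z hzδ (hsmall.trans (min_le_left _ _))
  have hτ2 : M * ((n + 1) * t + Δ ^ n) ≤ 1 / 2 := by
    have h1 : M * ((n + 1) * t) ≤ M * (1 / (4 * M)) := by
      gcongr; exact hsmall.trans (min_le_right _ _)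
    have h2 : M * (1 / (4 * M)) = 1 / 4 := by field_simp
    rw [mul_add]; linarith
  have hck0 : c n ^ k ≠ 0 := by
    rw [hc]
    have hb0 : (b : ℂ) ≠ 0 := by exact_mod_cast hb.ne'
    exact mul_ne_zero h.lead_ne_zero (pow_ne_zero _ (div_ne_zero hb0 (norm_pos_iff.1 hz₀)))
  rw [← heq, ← hc] at hτ
  have h3 : t ^ k ≤ 3 / 2 * ‖c n‖ ^ k := by
    have h4 : ‖(z - z₀) ^ k / c n ^ k‖ ≤ 3 / 2 := by
      have := norm_add_le ((z - z₀) ^ k / c n ^ k - 1) 1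
      rw [sub_add_cancel, norm_one] at this
      linarith
    rwa [norm_div, norm_pow, norm_pow, div_le_iff₀ (by
      rw [← norm_pow]; exact norm_pos_iff.2 hck0)] at h4
  have hcp : 0 < ‖c n‖ := norm_pos_iff.2 fun h0 => hck0 (by rw [h0, zero_pow hk0])
  refine lt_of_pow_lt_pow_left₀ k (by positivity) (h3.trans_lt ?_)
  rw [mul_pow]
  have : (2 : ℝ) ≤ 2 ^ k := by simpa using pow_le_pow_right₀ (one_le_two (α := ℝ)) hk
  have : 0 < ‖c n‖ ^ k := by positivity
  nlinarith

/-- The zeros of `(z - z₀)ᵏ - (b / z)ⁿ q(z) - eₙ(z)` near `z₀`. -/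
theorem exists_zeros (h : LocalEquation z₀ b Δ δ K q e) {k : ℕ} (hk : 1 ≤ k)
    {c : ℕ → ℂ} (hc : ∀ n, c n ^ k = q z₀ * (b / z₀) ^ n) {κ₀ ϱ Θ : ℝ}
    (hcn : ∀ n, ‖c n‖ = κ₀ * ϱ ^ n) (hϱ : 0 < ϱ) (hϱΘ : ϱ < Θ) (hΘ : Θ < 1) (hΔΘ : Δ ≤ Θ) :
    ∃ δ' > 0, δ' ≤ δ ∧ ∃ K' : ℝ, ∀ᶠ n : ℕ in atTop, ∃ ζ : Fin k → ℂ, Function.Injective ζ ∧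
      (∀ z, (z ∈ Metric.ball z₀ δ' ∧ (z - z₀) ^ k - (b / z) ^ n * q z - e n z = 0) ↔
        ∃ j, z = ζ j) ∧
      (∀ z ∈ Metric.ball z₀ δ', (z - z₀) ^ k - (b / z) ^ n * q z - e n z = 0 →
        deriv (fun z => (z - z₀) ^ k - (b / z) ^ n * q z - e n z) z ≠ 0) ∧
      ∀ j, ‖ζ j - (z₀ + c n * unityRoot k j)‖ ≤ K' * (ϱ * Θ) ^ n := by
  have hz₀ := h.norm_pos h.center_mem
  have hb := h.b_pos
  have hk0 : k ≠ 0 := by omega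
  have hΘ0 := hϱ.trans hϱΘ
  have hb0 : (b : ℂ) ≠ 0 := by exact_mod_cast hb.ne'
  have hck0 (n : ℕ) : c n ^ k ≠ 0 := by
    rw [hc]
    exact mul_ne_zero h.lead_ne_zero (pow_ne_zero _ (div_ne_zero hb0 (norm_pos_iff.1 hz₀)))
  have hc0 (n : ℕ) : c n ≠ 0 := fun h0 => hck0 n (by rw [h0, zero_pow hk0])
  have hκ₀ : 0 < κ₀ := by
    have := norm_pos_iff.2 (hc0 0)
    rw [hcn] at this
    simpa using this
  obtain ⟨κ, hκ, M, hM, hest⟩ := h.exists_rhs_estimate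
  obtain ⟨δ', hδ', hδδ, hout⟩ := h.exists_ball_zeros_small hk hc
  refine ⟨δ', hδ', hδδ, ?_⟩
  have hlimϱ : Tendsto (fun n : ℕ => 4 * κ₀ * ((n + 1 : ℝ) * ϱ ^ n)) atTop (𝓝 0) := by
    have h1 := (tendsto_self_mul_const_pow_of_lt_one hϱ.le (hϱΘ.trans hΘ)).comp
      (tendsto_add_atTop_nat 1)
    have h2 := h1.const_mul (4 * κ₀ / ϱ)
    rw [mul_zero] at h2
    refine h2.congr fun n => ?_
    simp only [Function.comp, pow_succ ϱ]
    push_cast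
    field_simp
  -- The strict inequality ϱ < Θ absorbs the factor n + 1 produced by the n-th power.
  have hratio : ∃ K₁ : ℝ, ∀ᶠ n : ℕ in atTop, (n + 1 : ℝ) * ϱ ^ n ≤ K₁ * Θ ^ n := by
    refine ⟨1, ?_⟩
    have hq1 : ϱ / Θ < 1 := (div_lt_one hΘ0).2 hϱΘ
    have hq0 : 0 < ϱ / Θ := by positivity
    have h1 := (tendsto_self_mul_const_pow_of_lt_one hq0.le hq1).add
      (tendsto_pow_atTop_nhds_zero_of_lt_one hq0.le hq1)
    rw [add_zero] at h1
    filter_upwards [h1.eventually_lt_const one_pos] with n hn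
    have h2 : (n : ℝ) * (ϱ / Θ) ^ n + (ϱ / Θ) ^ n = (n + 1) * ϱ ^ n / Θ ^ n := by
      rw [div_pow]; ring
    rw [h2, div_lt_iff₀ (by positivity)] at hn
    exact hn.le
  obtain ⟨K₁, hK₁⟩ := hratio
  set K₂ := M * (4 * κ₀ * K₁ + 1) with hK₂
  have hσlim : Tendsto (fun n : ℕ => K₂ * Θ ^ n) atTop (𝓝 0) := by
    simpa using (tendsto_pow_atTop_nhds_zero_of_lt_one hΘ0.le hΘ).const_mul K₂
  refine ⟨κ₀ * (2 * K₂), ?_⟩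
  filter_upwards [hout, hK₁, hlimϱ.eventually_lt_const hκ, hlimϱ.eventually_lt_const hδ',
    hσlim.eventually_lt_const (show (0 : ℝ) < 1 / 8 by norm_num)] with n hout hK₁ hnκ hnδ hσ
  have hcn4 : 4 * ‖c n‖ ≤ 4 * κ₀ * ((n + 1 : ℝ) * ϱ ^ n) := by
    rw [hcn]
    have : 0 ≤ κ₀ * (n * ϱ ^ n) := by positivity
    linarith
  have hball (v : ℂ) (hv : v ∈ Metric.ball (0 : ℂ) 4) : z₀ + c n * v ∈ Metric.ball z₀ δ' := by
    have hv' : ‖v‖ < 4 := by simpa using hv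
    rw [Metric.mem_ball, dist_eq_norm, add_sub_cancel_left, norm_mul]
    nlinarith [norm_nonneg (c n)]
  have hballδ (v : ℂ) (hv : v ∈ Metric.ball (0 : ℂ) 4) : z₀ + c n * v ∈ Metric.ball z₀ δ :=
    Metric.ball_subset_ball hδδ (hball v hv)
  set rhs : ℂ → ℂ := fun z => (b / z) ^ n * q z + e n z with hrhs
  have hrhsd : DifferentiableOn ℂ rhs (Metric.ball z₀ δ) := by
    refine (DifferentiableOn.mul (DifferentiableOn.pow (DifferentiableOn.div
      (differentiableOn_const _) differentiableOn_id fun z hz => ?_) n) h.lead_diff).add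
      (h.error_diff n)
    exact norm_pos_iff.1 (h.norm_pos hz)
  -- The relative error of the right-hand side in the rescaled variable v = (z - z₀)/cₙ.
  set τ : ℂ → ℂ := fun v => rhs (z₀ + c n * v) / c n ^ k - 1 with hτ
  have hτd : DifferentiableOn ℂ τ (Metric.ball 0 4) := by
    refine ((hrhsd.comp ?_ hballδ).div_const _).sub_const _
    fun_prop
  have hτσ (v : ℂ) (hv : v ∈ Metric.ball (0 : ℂ) 4) : ‖τ v‖ ≤ K₂ * Θ ^ n := by
    have hv' : ‖v‖ < 4 := by simpa using hv
    have hs : (n + 1) * ‖z₀ + c n * v - z₀‖ ≤ 4 * κ₀ * ((n + 1 : ℝ) * ϱ ^ n) := by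
      rw [add_sub_cancel_left, norm_mul, hcn]
      have h1 : 0 ≤ (n + 1 : ℝ) * (κ₀ * ϱ ^ n) := by positivity
      nlinarith
    have h1 := hest n _ (hballδ v hv) (hs.trans hnκ.le)
    rw [← hc] at h1
    refine h1.trans ?_
    have h2 : Δ ^ n ≤ Θ ^ n := by have := h.Δ_pos; gcongr
    calc M * ((n + 1) * ‖z₀ + c n * v - z₀‖ + Δ ^ n)
        ≤ M * (4 * κ₀ * (K₁ * Θ ^ n) + Θ ^ n) := by
          have := hs.trans (mul_le_mul_of_nonneg_left hK₁ (by positivity : 0 ≤ 4 * κ₀))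
          gcongr
      _ = _ := by rw [hK₂]; ring
  obtain ⟨v, hvinj, hvclose, hviff, hvsimple⟩ := exists_roots_of_perturbation hk hσ.le hτd hτσ
  have hv2 (j : Fin k) : v j ∈ Metric.ball (0 : ℂ) 2 := by
    have h1 := norm_sub_norm_le (v j) (unityRoot k j)
    rw [norm_unityRoot] at h1
    have h2 := hvclose j
    rw [mem_ball_zero_iff]
    linarith
  have hsub24 : Metric.ball (0 : ℂ) 2 ⊆ Metric.ball 0 4 := Metric.ball_subset_ball (by norm_num)
  have hscale (x : ℂ) : (z₀ + c n * x - z₀) ^ k - (b / (z₀ + c n * x)) ^ n * q (z₀ + c n * x)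
      - e n (z₀ + c n * x) = c n ^ k * (x ^ k - (1 + τ x)) := by
    have h1 : c n ^ k * (1 + τ x) = rhs (z₀ + c n * x) := by
      rw [hτ]
      simp only
      rw [add_sub_cancel, mul_div_cancel₀ _ (hck0 n)]
    rw [mul_sub, h1, hrhs, add_sub_cancel_left, mul_pow]
    ring
  -- Every solution in the fixed ball, not only those at scale |cₙ|, has rescaled modulus below 2
  -- and so is among the k constructed roots.
  have hpull {z : ℂ} (hz : z ∈ Metric.ball z₀ δ')
      (hf : (z - z₀) ^ k - (b / z) ^ n * q z - e n z = 0) :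
      ∃ x ∈ Metric.ball (0 : ℂ) 2, z = z₀ + c n * x ∧ x ^ k = 1 + τ x := by
    have h1 := hout z hz (by linear_combination hf)
    have hzx : z = z₀ + c n * ((z - z₀) / c n) := by
      rw [mul_div_cancel₀ _ (hc0 n)]; ring
    refine ⟨(z - z₀) / c n, ?_, hzx, ?_⟩
    · rw [mem_ball_zero_iff, norm_div, div_lt_iff₀ (norm_pos_iff.2 (hc0 n))]
      exact h1
    · rw [hzx, hscale] at hf
      exact sub_eq_zero.1 ((mul_eq_zero.1 hf).resolve_left (hck0 n))
  refine ⟨fun j => z₀ + c n * v j, ?_, fun z => ⟨?_, ?_⟩, ?_, fun j => ?_⟩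
  · intro i j hij
    exact hvinj (mul_left_cancel₀ (hc0 n) (add_left_cancel hij))
  · rintro ⟨hz, hf⟩
    obtain ⟨x, hx, rfl, hxk⟩ := hpull hz hf
    obtain ⟨j, rfl⟩ := (hviff x hx).1 hxk
    exact ⟨j, rfl⟩
  · rintro ⟨j, rfl⟩
    refine ⟨hball _ (hsub24 (hv2 j)), ?_⟩
    rw [hscale, (hviff _ (hv2 j)).2 ⟨j, rfl⟩, sub_self, mul_zero]
  · intro z hz hf hder
    obtain ⟨x, hx, rfl, hxk⟩ := hpull hz hf
    apply hvsimple x hx hxk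
    have hzδ := hballδ x (hsub24 hx)
    have hfd : DifferentiableAt ℂ (fun z => (z - z₀) ^ k - (b / z) ^ n * q z - e n z)
        (z₀ + c n * x) := by
      have h1 := hrhsd.differentiableAt (Metric.isOpen_ball.mem_nhds hzδ)
      have h2 : (fun z => (z - z₀) ^ k - (b / z) ^ n * q z - e n z)
          = fun z => (z - z₀) ^ k - rhs z := by ext z; rw [hrhs]; ring
      rw [h2]
      exact ((differentiableAt_id.sub_const _).pow k).sub h1
    have hd1 := hfd.hasDerivAt
    rw [hder] at hd1
    have hlin : HasDerivAt (fun x : ℂ => z₀ + c n * x) (c n * 1) x :=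
      ((hasDerivAt_id x).const_mul (c n)).const_add z₀
    have hd2 := hd1.comp x hlin
    have hτx := (hτd.differentiableAt (Metric.isOpen_ball.mem_nhds (hsub24 hx))).hasDerivAt
    have hd3 : HasDerivAt (fun x => c n ^ k * (x ^ k - (1 + τ x)))
        (c n ^ k * (k * x ^ (k - 1) - deriv τ x)) x :=
      ((hasDerivAt_pow k x).sub (hτx.const_add 1)).const_mul _
    have hfun : ((fun z => (z - z₀) ^ k - (b / z) ^ n * q z - e n z) ∘ fun x : ℂ => z₀ + c n * x)
        = fun x => c n ^ k * (x ^ k - (1 + τ x)) := by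
      ext x; exact hscale x
    rw [hfun] at hd2
    have := hd2.unique hd3
    rw [zero_mul] at this
    exact sub_eq_zero.1 ((mul_eq_zero.1 this.symm).resolve_left (hck0 n))
  · have h1 : z₀ + c n * v j - (z₀ + c n * unityRoot k j) = c n * (v j - unityRoot k j) := by ring
    rw [h1, norm_mul, hcn]
    calc κ₀ * ϱ ^ n * ‖v j - unityRoot k j‖ ≤ κ₀ * ϱ ^ n * (2 * (K₂ * Θ ^ n)) := by
          gcongr; exact hvclose j
      _ = _ := by rw [mul_pow]; ring

end LocalEquation

end OPUC

/-! ### From the BLS condition to the zeros of φₙ. -/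

namespace OPUC

/-- The rate is weakened to max Δ b because the convergence of Φₙ* contributes errors of order b²ⁿ
in any case. The asymptotic bound is also made uniform in n. -/
lemma BLSCondition.exists_leadingDecay {μ : Measure ℂ} {C : ℂ} {b Δ : ℝ}
    (hb : b ∈ Set.Ioo (0 : ℝ) 1) (hΔ : Δ ∈ Set.Ioo (0 : ℝ) 1) (h : BLSCondition μ C b Δ) :
    ∃ A, LeadingDecay (verblunsky μ) C b (max Δ b) A := by
  obtain ⟨A, hA, hbound⟩ := bound_of_isBigO_nat_atTop h
  have hb0 := hb.1
  have hΔ0 := hΔ.1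
  have herr (n : ℕ) : ‖verblunsky μ n - C * (b : ℂ) ^ n‖ ≤ A * (b * Δ) ^ n := by
    have := @hbound n (by positivity)
    rwa [Real.norm_of_nonneg (by positivity)] at this
  refine ⟨‖C‖ + A, ⟨hb0, hb.2, fun n => ?_⟩, le_max_right _ _, max_lt hΔ.2 hb.2, fun n => ?_⟩
  · have h1 := norm_add_le (verblunsky μ n - C * (b : ℂ) ^ n) (C * (b : ℂ) ^ n)
    rw [sub_add_cancel, norm_mul, norm_pow, Complex.norm_real, Real.norm_of_nonneg hb0.le] at h1
    have h2 : (b * Δ) ^ n ≤ b ^ n := by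
      gcongr
      exact mul_le_of_le_one_right hb0.le hΔ.2.le
    have h3 : A * (b * Δ) ^ n ≤ A * b ^ n := by gcongr
    linarith [herr n]
  · refine (herr n).trans ?_
    gcongr
    · linarith [norm_nonneg C]
    · exact le_max_left _ _

/-- The continuation of the reciprocal of the Szegő function. -/
noncomputable def szegoInv (μ : Measure ℂ) (z : ℂ) : ℂ :=
  szegoLimit (verblunsky μ) z / Real.sqrt (∫ z, ‖szegoLimit (verblunsky μ) z‖ ^ 2 ∂μ)

lemma ExpDecay.isSzegoInvContinuation {μ : Measure ℂ} {b A : ℝ} (hμ : IsNontrivialCircleMeasure μ)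
    (h : ExpDecay (verblunsky μ) b A) : IsSzegoInvContinuation μ b⁻¹ (szegoInv μ) where
  analytic := (h.differentiableOn_szegoLimit.div_const _).analyticOnNhd Metric.isOpen_ball
  eq_inv z hz := by rw [h.szegoD_eq hμ (by simpa using hz), inv_div, szegoInv]

/-- Near a zero of the reflected Szegő limit in the annulus `b < |z| < 1`, the polynomials `Φₙ`
are given, up to a zero-free factor, by a local equation. -/
theorem LeadingDecay.exists_localEquation {α : ℕ → ℂ} {c : ℂ} {b Δ A : ℝ}
    (h : LeadingDecay α c b Δ A) (hα : ∀ n, ‖α n‖ < 1) (hc : c ≠ 0) {z₀ : ℂ} (hz₀ : b < ‖z₀‖)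
    (hz₀1 : ‖z₀‖ < 1) {k : ℕ} {H : ℂ → ℂ} (hH : AnalyticAt ℂ H z₀) (hH0 : H z₀ ≠ 0)
    (hg : ∀ᶠ z in 𝓝 z₀, conj (szegoLimit α (1 / conj z)) = (z - z₀) ^ k * H z) :
    ∃ (δ K : ℝ) (q : ℂ → ℂ) (e : ℕ → ℂ → ℂ), LocalEquation z₀ b Δ δ K q e ∧
      ∀ n, ∃ U : ℂ → ℂ, DifferentiableOn ℂ U (Metric.ball z₀ δ) ∧
        (∀ z ∈ Metric.ball z₀ δ, U z ≠ 0) ∧ ∀ z ∈ Metric.ball z₀ δ, (szegoPoly α n).eval z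
          = U z * ((z - z₀) ^ k - (b / z) ^ n * q z - e n z) := by
  have hb := h.pos
  have hΔ := h.rate_pos
  have hbΔ : b * Δ < b := by nlinarith [h.rate_lt_one]
  have hnorm {z : ℂ} (hz : b < ‖z‖) : z - b ≠ 0 := by
    intro h0
    rw [sub_eq_zero.1 h0, Complex.norm_real, Real.norm_of_nonneg hb.le] at hz
    exact lt_irrefl _ hz
  -- Dividing the expansion by the zero-free factor H leaves the pure power (z - z₀)^k; the signs
  -- move the other terms to the right-hand side.
  set q : ℂ → ℂ := fun z => -(conj c * szegoLimit α z / (z - b)) / H z with hq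
  set e : ℕ → ℂ → ℂ := fun n z => -remainder α c b n z / H z with he
  have hann : ∀ᶠ z in 𝓝 z₀, b < ‖z‖ ∧ ‖z‖ < 1 :=
    ((isOpen_lt continuous_const continuous_norm).inter
      (isOpen_lt continuous_norm continuous_const)).mem_nhds ⟨hz₀, hz₀1⟩
  have hqd {z : ℂ} (hz : b < ‖z‖) (hz1 : ‖z‖ < 1) (hHz : DifferentiableAt ℂ H z) (hHz0 : H z ≠ 0) :
      DifferentiableAt ℂ q z :=
    ((((h.differentiableAt_szegoLimit (h.norm_lt_inv hz1.le)).const_mul _).div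
      (differentiableAt_id.sub_const _) (hnorm hz)).neg).div hHz hHz0
  have hqz₀ := hqd hz₀ hz₀1 hH.differentiableAt hH0
  have hH2 : ∀ᶠ z in 𝓝 z₀, ‖H z₀‖ / 2 < ‖H z‖ :=
    hH.continuousAt.norm.eventually_const_lt (half_lt_self (norm_pos_iff.2 hH0))
  have hHd : ∀ᶠ z in 𝓝 z₀, DifferentiableAt ℂ H z :=
    hH.eventually_analyticAt.mono fun z hz => hz.differentiableAt
  have hqb : ∀ᶠ z in 𝓝 z₀, ‖q z‖ < ‖q z₀‖ + 1 :=
    hqz₀.continuousAt.norm.eventually_lt_const (lt_add_one _)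
  obtain ⟨L, hL, hlip⟩ := hqz₀.isBigO_sub.exists_pos
  obtain ⟨δ, hδ, hball⟩ := Metric.eventually_nhds_iff_ball.1
    (hann.and (hH2.and (hHd.and (hqb.and (hlip.bound.and hg)))))
  have hHne {z : ℂ} (hz : z ∈ Metric.ball z₀ δ) : H z ≠ 0 := by
    have := (hball z hz).2.1
    exact norm_pos_iff.1 ((by positivity : (0 : ℝ) ≤ ‖H z₀‖ / 2).trans_lt this)
  have hz0 {z : ℂ} (hz : z ∈ Metric.ball z₀ δ) : z ≠ 0 :=
    norm_pos_iff.1 (hb.trans (hball z hz).1.1)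
  set K₁ := h.remConst / (b - b * Δ) / (‖H z₀‖ / 2) with hK₁
  have hK₁0 : 0 ≤ K₁ := by
    have := h.remConst_nonneg
    have := sub_pos.2 hbΔ
    positivity
  refine ⟨δ, (‖q z₀‖ + 1) + L + K₁, q, e, ?_, fun n => ?_⟩
  · refine ⟨hb, hΔ, h.rate_lt_one, hδ, fun z hz => (hball z hz).1.1, fun z hz => ?_, ?_,
      fun z hz => ?_, fun z hz => ?_, fun n z hz => ?_, fun n z hz => ?_⟩
    · obtain ⟨hz1, -, hz3, -⟩ := hball z hz
      exact (hqd hz1.1 hz1.2 hz3 (hHne hz)).differentiableWithinAt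
    · have h1 := h.szegoLimit_ne_zero hα hz₀1.le
      have h2 : conj c ≠ 0 := by simpa using hc
      exact div_ne_zero (neg_ne_zero.2 (div_ne_zero (mul_ne_zero h2 h1) (hnorm hz₀))) hH0
    · linarith [(hball z hz).2.2.2.1]
    · refine (hball z hz).2.2.2.2.1.trans ?_
      gcongr
      linarith [norm_nonneg (q z₀)]
    · obtain ⟨hz1, -, hz3, -⟩ := hball z hz
      exact ((h.differentiableAt_remainder n hz1.2 (hbΔ.trans hz1.1)).neg.div hz3
        (hHne hz)).differentiableWithinAt
    · obtain ⟨hz1, hz2, -⟩ := hball z hz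
      have hzp := hb.trans hz1.1
      have hHp : 0 < ‖H z₀‖ := norm_pos_iff.2 hH0
      have hpow : 0 ≤ (b * Δ / ‖z‖) ^ n := by positivity
      rw [he]
      simp only
      rw [norm_div, norm_neg]
      calc ‖remainder α c b n z‖ / ‖H z‖
          ≤ (h.remConst / (‖z‖ - b * Δ) * (b * Δ / ‖z‖) ^ n) / (‖H z₀‖ / 2) := by
            have h1 := h.norm_remainder_le n hz1.2.le (hbΔ.trans hz1.1)
            gcongr
            exact (norm_nonneg _).trans h1
        _ ≤ (h.remConst / (b - b * Δ) * (b * Δ / ‖z‖) ^ n) / (‖H z₀‖ / 2) := by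
            have := h.remConst_nonneg
            have := sub_pos.2 hbΔ
            gcongr
            exact hz1.1.le
        _ = K₁ * (b * Δ / ‖z‖) ^ n := by rw [hK₁]; ring
        _ ≤ _ := by
            gcongr
            linarith [norm_nonneg (q z₀)]
  · refine ⟨fun z => z ^ n * H z, fun z hz => ?_, fun z hz => ?_, fun z hz => ?_⟩
    · exact ((differentiableAt_id.pow n).mul (hball z hz).2.2.1).differentiableWithinAt
    · exact mul_ne_zero (pow_ne_zero _ (hz0 hz)) (hHne hz)
    · obtain ⟨hz1, -, -, -, -, hz6⟩ := hball z hz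
      have hHz := hHne hz
      rw [(eval_szego_reflect α (hz0 hz) n).1, h.conj_szegoRev_eq n hz1.2.le hz1.1, hz6, hq, he]
      simp only
      field_simp
      ring

lemma polyNorm_ne_zero {μ : Measure ℂ} (hμ : IsNontrivialCircleMeasure μ) {P : ℂ[X]} (hP : P ≠ 0) :
    polyNorm μ P ≠ 0 :=
  (Real.sqrt_pos.2 (integral_norm_sq_pos hμ hP)).ne'

/-- If all zeros of `Φₙ` in a disk are simple, and listed without repetition by `ζ`, then `ζ` is
the multiset of zeros of `φₙ` in that disk. -/
lemma zerosInBall_orthonormalOP {μ : Measure ℂ} (hμ : IsNontrivialCircleMeasure μ) {n k : ℕ}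
    {z₀ : ℂ} {r : ℝ} {ζ : Fin k → ℂ} (hζ : Function.Injective ζ)
    (hiff : ∀ z, (z ∈ Metric.ball z₀ r ∧ (monicOP μ n).eval z = 0) ↔ ∃ j, z = ζ j)
    (hsimple : ∀ z ∈ Metric.ball z₀ r, (monicOP μ n).eval z = 0 →
      (monicOP μ n).derivative.eval z ≠ 0) :
    zerosInBall (orthonormalOP μ n) z₀ r = Finset.univ.val.map ζ := by
  classical
  have hne := (monicOP_monic μ n).ne_zero
  have ha : (((polyNorm μ (monicOP μ n))⁻¹ : ℝ) : ℂ) ≠ 0 := by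
    exact_mod_cast inv_ne_zero (polyNorm_ne_zero hμ hne)
  rw [zerosInBall, orthonormalOP, roots_C_mul _ ha]
  refine (Multiset.Nodup.ext ?_ ?_).2 fun z => ?_
  · rw [Multiset.nodup_iff_count_le_one]
    intro z
    by_cases hz : z ∈ Metric.ball z₀ r
    · rw [Multiset.count_filter_of_pos hz, count_roots]
      by_contra! hlt
      obtain ⟨h1, h2⟩ := (one_lt_rootMultiplicity_iff_isRoot hne).1 hlt
      exact hsimple z hz h1 h2
    · rw [Multiset.count_filter_of_neg hz]; exact zero_le_one
  · exact (Multiset.nodup_map_iff_of_injective hζ).2 Finset.univ.nodup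
  · rw [Multiset.mem_filter, mem_roots hne, IsRoot.def, and_comm, hiff]
    simp [eq_comm]

lemma rpow_div_natCast {x : ℝ} (hx : 0 ≤ x) (n k : ℕ) :
    x ^ ((n : ℝ) / (k : ℝ)) = (x ^ ((k : ℝ)⁻¹)) ^ n := by
  rw [← Real.rpow_mul_natCast hx]
  congr 1; ring

end OPUC

theorem theorem4p5 (b Δ : ℝ) (hb : b ∈ Set.Ioo (0 : ℝ) 1) (hΔ : Δ ∈ Set.Ioo (0 : ℝ) 1) :
    ∃ Δ₂ ∈ Set.Ioo (0 : ℝ) 1, ∀ (μ : Measure ℂ) (C : ℂ),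
      OPUC.IsNontrivialCircleMeasure μ → C ≠ 0 → OPUC.BLSCondition μ C b Δ →
      ∃ G : ℂ → ℂ, OPUC.IsSzegoInvContinuation μ b⁻¹ G ∧
      ∃ Δ₃ ∈ Set.Ioo (0 : ℝ) 1, ∀ (z₀ : ℂ) (k : ℕ), b < ‖z₀‖ → ‖z₀‖ < b * Δ₂⁻¹ → 1 ≤ k →
        analyticOrderAt (fun z : ℂ => conj (G (1 / conj z))) z₀ = (k : ℕ∞) →
        ∃ C₁ : ℂ, C₁ ≠ 0 ∧ ∃ δ : ℝ, 0 < δ ∧ ∃ ζ : ℕ → Fin k → ℂ,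
          (∀ᶠ n : ℕ in atTop,
            OPUC.zerosInBall (OPUC.orthonormalOP μ n) z₀ δ = Finset.univ.val.map (ζ n)) ∧
          ∀ j : Fin k,
            (fun n : ℕ => ζ n j -
              (z₀ + C₁ * (((b / ‖z₀‖) ^ ((n : ℝ) / (k : ℝ)) : ℝ) : ℂ) *
                Complex.exp (-Complex.I * ((n : ℂ) / (k : ℂ)) * (Complex.arg z₀ : ℂ)) *
                Complex.exp (2 * (Real.pi : ℂ) * Complex.I * ((j : ℕ) : ℂ) / (k : ℂ))))
              =O[atTop] fun n : ℕ => (b * Δ₃ / ‖z₀‖) ^ ((n : ℝ) / (k : ℝ)) := by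
  -- Taking Δ₂ = b turns the condition on z₀ into b < |z₀| < 1, the range of the annular expansion.
  refine ⟨b, hb, fun μ C hμ hC hBLS => ?_⟩
  obtain ⟨A, h⟩ := hBLS.exists_leadingDecay hb hΔ
  refine ⟨OPUC.szegoInv μ, h.isSzegoInvContinuation hμ, ?_⟩
  obtain ⟨r, hbr, hr⟩ := h.exists_radius_le_of_zero
  have hb0 := hb.1
  have hr0 := hb0.trans hbr
  -- Δ₃ exceeds both the error rate and b/r, where r bounds from below the moduli of all zeros in
  -- the annulus; hence b/|z₀| < Δ₃ uniformly in z₀.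
  obtain ⟨Δ₃, hΔ₃, hΔ₃1⟩ := exists_between (max_lt h.rate_lt_one ((div_lt_one hr0).2 hbr))
  have hΔ₃0 : 0 < Δ₃ := h.rate_pos.trans ((le_max_left _ _).trans_lt hΔ₃)
  refine ⟨Δ₃, ⟨hΔ₃0, hΔ₃1⟩, fun z₀ k hz₀ hz₀1 hk hord => ?_⟩
  rw [mul_inv_cancel₀ hb0.ne'] at hz₀1
  have hk0 : k ≠ 0 := by omega
  set α := OPUC.verblunsky μ with hα
  set N := ∫ z, ‖OPUC.szegoLimit α z‖ ^ 2 ∂μ with hN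
  have hN0 : (Real.sqrt N : ℂ) ≠ 0 := by
    exact_mod_cast (Real.sqrt_pos.2 (h.integral_norm_sq_szegoLimit_pos hμ)).ne'
  have hGF (z : ℂ) : conj (OPUC.szegoInv μ (1 / conj z))
      = conj (OPUC.szegoLimit α (1 / conj z)) / Real.sqrt N := by
    rw [OPUC.szegoInv, map_div₀, Complex.conj_ofReal]
  have han : AnalyticAt ℂ (fun z : ℂ => conj (OPUC.szegoInv μ (1 / conj z))) z₀ := by
    rw [Complex.analyticAt_iff_eventually_differentiableAt]
    filter_upwards [(isOpen_lt continuous_const continuous_norm).mem_nhds hz₀] with z hz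
    simp_rw [hGF]
    exact (h.differentiableAt_conj_szegoLimit hz).div_const _
  obtain ⟨H, hH, hH0, hHeq⟩ := (han.analyticOrderAt_eq_natCast).1 hord
  have hg : ∀ᶠ z in 𝓝 z₀, conj (OPUC.szegoLimit α (1 / conj z))
      = (z - z₀) ^ k * (Real.sqrt N * H z) := by
    filter_upwards [hHeq] with z hz
    rw [hGF, div_eq_iff hN0] at hz
    rw [hz, smul_eq_mul]; ring
  have hrz : r ≤ ‖z₀‖ := by
    refine hr z₀ hz₀ hz₀1 ?_
    rw [hg.self_of_nhds, sub_self, zero_pow hk0, zero_mul]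
  obtain ⟨δ, K, q, e, hloc, hfac⟩ := h.exists_localEquation (OPUC.norm_verblunsky_lt_one hμ) hC hz₀ hz₀1
    (analyticAt_const.mul hH) (mul_ne_zero hN0 hH0) hg
  -- Any k-th root of q(z₀) will do; another choice only permutes the labels j.
  obtain ⟨C₁, hC₁⟩ := IsAlgClosed.exists_pow_nat_eq (q z₀) (Nat.pos_of_ne_zero hk0)
  have hz₀p := hb0.trans hz₀
  set ϱ := (b / ‖z₀‖) ^ ((k : ℝ)⁻¹) with hϱ
  set Θ := Δ₃ ^ ((k : ℝ)⁻¹) with hΘ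
  have hkinv0 : 0 < (k : ℝ)⁻¹ := by positivity
  have hkinv1 : (k : ℝ)⁻¹ ≤ 1 := inv_le_one_of_one_le₀ (by exact_mod_cast hk)
  have hϱ0 : 0 < ϱ := by positivity
  have hϱΘ : ϱ < Θ := by
    refine Real.rpow_lt_rpow (by positivity) ?_ hkinv0
    exact (div_le_div_of_nonneg_left hb0.le hr0 hrz).trans_lt ((le_max_right _ _).trans_lt hΔ₃)
  have hΘ1 : Θ < 1 := Real.rpow_lt_one hΔ₃0.le hΔ₃1 hkinv0
  -- Since Δ₃ < 1, taking its k-th root only increases it.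
  have hΔΘ : max Δ b ≤ Θ := by
    refine ((le_max_left _ _).trans hΔ₃.le).trans ?_
    simpa using Real.rpow_le_rpow_of_exponent_ge hΔ₃0 hΔ₃1.le hkinv1
  set E : ℕ → ℂ := fun n =>
    Complex.exp (-Complex.I * ((n : ℂ) / (k : ℂ)) * (Complex.arg z₀ : ℂ)) with hE
  have hEnorm (n : ℕ) : ‖E n‖ = 1 := by
    have : -Complex.I * ((n : ℂ) / (k : ℂ)) * (Complex.arg z₀ : ℂ)
        = ((-(n / k * Complex.arg z₀) : ℝ) : ℂ) * Complex.I := by push_cast; ring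
    rw [hE]
    simp only
    rw [this, Complex.norm_exp_ofReal_mul_I]
  have hEpow (n : ℕ) : E n ^ k = Complex.exp (-(Complex.arg z₀ * Complex.I)) ^ n := by
    rw [hE]
    simp only
    rw [← Complex.exp_nat_mul, ← Complex.exp_nat_mul]
    congr 1
    have : (k : ℂ) ≠ 0 := by exact_mod_cast hk0
    field_simp
  have hϱk : ϱ ^ k = b / ‖z₀‖ := Real.rpow_inv_natCast_pow (by positivity) hk0
  -- The k-th root of q(z₀)(b/z₀)ⁿ with phase exp(-i n arg(z₀)/k), as prescribed in the asymptotics.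
  set c : ℕ → ℂ := fun n => C₁ * ((ϱ ^ n : ℝ) : ℂ) * E n with hcdef
  have hc (n : ℕ) : c n ^ k = q z₀ * (b / z₀) ^ n := by
    have h1 : ((ϱ ^ n : ℝ) : ℂ) ^ k = ((b : ℂ) / ‖z₀‖) ^ n := by
      rw [← Complex.ofReal_pow, pow_right_comm, hϱk]; push_cast; rfl
    have h2 : (b / z₀ : ℂ) = b / ‖z₀‖ * Complex.exp (-(Complex.arg z₀ * Complex.I)) := by
      conv_lhs => rw [← Complex.norm_mul_exp_arg_mul_I z₀]
      rw [Complex.exp_neg]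
      field_simp
    rw [hcdef]
    simp only
    rw [mul_pow, mul_pow, hC₁, h1, hEpow, h2, mul_pow, mul_assoc]
  have hcn (n : ℕ) : ‖c n‖ = ‖C₁‖ * ϱ ^ n := by
    rw [hcdef]
    simp only
    rw [norm_mul, norm_mul, hEnorm, mul_one, Complex.norm_real, Real.norm_of_nonneg (by positivity)]
  obtain ⟨δ', hδ', hδδ, K', hev⟩ := hloc.exists_zeros hk hc hcn hϱ0 hϱΘ hΘ1 hΔΘ
  have hC₁0 : C₁ ≠ 0 := by
    rintro rfl
    rw [zero_pow hk0] at hC₁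
    exact hloc.lead_ne_zero hC₁.symm
  obtain ⟨ζ, hζ⟩ := hev.choice
  refine ⟨C₁, hC₁0, δ', hδ', ζ, ?_, fun j => ?_⟩
  · filter_upwards [hζ] with n hn
    obtain ⟨hinj, hiff, hsimple, -⟩ := hn
    obtain ⟨U, hUd, hU0, hUeq⟩ := hfac n
    have hsub : Metric.ball z₀ δ' ⊆ Metric.ball z₀ δ := Metric.ball_subset_ball hδδ
    have hzero {z : ℂ} (hz : z ∈ Metric.ball z₀ δ') : (OPUC.monicOP μ n).eval z = 0 ↔
        (z - z₀) ^ k - (b / z) ^ n * q z - e n z = 0 := by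
      rw [OPUC.monicOP_eq_szegoPoly hμ, hUeq z (hsub hz), mul_eq_zero, or_iff_right (hU0 z (hsub hz))]
    refine OPUC.zerosInBall_orthonormalOP hμ hinj (fun z => ?_) fun z hz hz0 => ?_
    · rw [← hiff z]
      exact and_congr_right fun hz => hzero hz
    · have hf0 := (hzero hz).1 hz0
      have hf' := hsimple z hz hf0
      have hnhds := Metric.isOpen_ball.mem_nhds (hsub hz)
      have hUz := (hUd.differentiableAt hnhds).hasDerivAt
      have hprod := hUz.mul (differentiableAt_of_deriv_ne_zero hf').hasDerivAt
      have hP : HasDerivAt (fun z => (OPUC.monicOP μ n).eval z)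
          ((OPUC.monicOP μ n).derivative.eval z) z := (OPUC.monicOP μ n).hasDerivAt z
      have hcongr : (fun z => (OPUC.monicOP μ n).eval z) =ᶠ[𝓝 z]
          U * fun z => (z - z₀) ^ k - (b / z) ^ n * q z - e n z := by
        filter_upwards [hnhds] with w hw
        rw [OPUC.monicOP_eq_szegoPoly hμ, hUeq w hw, Pi.mul_apply]
      -- At a zero the product rule leaves only the zero-free factor U times the derivative of the
      -- local equation, so simplicity transfers to Φₙ.
      rw [hP.unique (hprod.congr_of_eventuallyEq hcongr), hf0, mul_zero, zero_add]
      exact mul_ne_zero (hU0 z (hsub hz)) hf'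
  · refine IsBigO.of_bound K' ?_
    filter_upwards [hζ] with n hn
    have h1 := hn.2.2.2 j
    have h2 : (b * Δ₃ / ‖z₀‖) ^ ((n : ℝ) / (k : ℝ)) = (ϱ * Θ) ^ n := by
      rw [OPUC.rpow_div_natCast (by positivity), hϱ, hΘ, ← Real.mul_rpow (by positivity) hΔ₃0.le]
      congr 2; ring
    rw [Real.norm_of_nonneg (by positivity), h2, OPUC.rpow_div_natCast (by positivity), ← hϱ]
    exact h1
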